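/- All varieties are over $\mathbb{C}$, with the Zariski topology and the reduced structure. For non-negative integers $w, r$ let $$O_{(w-r,r)}=\{t\in\operatorname{End}(\mathbb{C}^w)\;|\;t^2=0,\ \operatorname{rank} t=r\},$$ a subvariety of the affine space $\operatorname{End}(\mathbb{C}^w)$. Let $w^1,r^1,w^2,r^2,r$ be non-negative integers, let $t\in O_{(w^1+w^2-r,\,r)}$, and let $$\mathfrak{S}_2(((w^1,r^1),(w^2,r^2)),(w^1+w^2,r))=\{X\subset\mathbb{C}^{w^1+w^2}\;|\;\dim X=w^1,\ tX\subset X,\ \operatorname{rank}(t|_X)=r^1,\ \operatorname{rank}(t|_{\mathbb{C}^{w^1+w^2}/X})=r^2\}$$ be the two-step Spaltenstein variety of $t$, a subset of the Grassmannian of $w^1$-dimensional subspaces of $\mathbb{C}^{w^1+w^2}$, which is regarded as a projective variety by the Plücker embedding. \textbf{Proposition.} If $$r^1+r^2\le r\le\min(w^2-r^2+r^1,\;w^1-r^1+r^2),$$ then $\mathfrak{S}_2(((w^1,r^1),(w^2,r^2)),(w^1+w^2,r))$ is a smooth connected (in particular non-empty) quasi-projective variety of dimension $$w^1w^2+\tfrac12\left(\dim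 O_{(w^1-r^1,r^1)}+\dim O_{(w^2-r^2,r^2)}-\dim O_{(w^1+w^2-r,r)}\right).$$ Otherwise $\mathfrak{S}_2(((w^1,r^1),(w^2,r^2)),(w^1+w^2,r))$ is empty. -/

import Mathlib

open scoped LinearAlgebra.Projectivization

namespace Spaltenstein

noncomputable section

/-! ### Classical algebraic geometry over the complex numbers

Varieties are sets of closed points with the Zariski topology and the reduced structure. -/

/-- The Zariski topology on affine space `ι → ℂ`: the non-vanishing loci of polynomials
(which are closed under finite intersections) are a basis of open sets. -/
@[reducible] def zariskiAffine (ι : Type) : TopologicalSpace (ι → ℂ) :=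
  TopologicalSpace.generateFrom
    {U | ∃ f : MvPolynomial ι ℂ, U = {x | MvPolynomial.eval x f ≠ 0}}

/-- The Zariski topology on the projective space of lines in `ι → ℂ`: the non-vanishing loci of
homogeneous polynomials (which are closed under finite intersections) are a basis of open sets. -/
@[reducible] def zariskiProj (ι : Type) : TopologicalSpace (ℙ ℂ (ι → ℂ)) :=
  TopologicalSpace.generateFrom
    {U | ∃ (m : ℕ) (f : MvPolynomial ι ℂ), f.IsHomogeneous m ∧
      U = {p | MvPolynomial.eval p.rep f ≠ 0}}

/-- The dimension of a subset of affine space: its Krull dimension as a topological space,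
for the induced Zariski topology (so `⊥` for the empty set). -/
def affineDim {ι : Type} (Z : Set (ι → ℂ)) : WithBot ℕ∞ :=
  @topologicalKrullDim Z ((zariskiAffine ι).induced Subtype.val)

/-- The dimension of a subset of projective space: its Krull dimension as a topological space,
for the induced Zariski topology (so `⊥` for the empty set). -/
def projDim {ι : Type} (Z : Set (ℙ ℂ (ι → ℂ))) : WithBot ℕ∞ :=
  @topologicalKrullDim Z ((zariskiProj ι).induced Subtype.val)

/-- The dimension of `Z` at the point `p`: the least dimension of `Z ∩ U` over all
Zariski open neighbourhoods `U` of `p`. -/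
def localDim {ι : Type} (Z : Set (ℙ ℂ (ι → ℂ))) (p : ℙ ℂ (ι → ℂ)) : WithBot ℕ∞ :=
  ⨅ (U : Set (ℙ ℂ (ι → ℂ))) (_ : @IsOpen _ (zariskiProj ι) U ∧ p ∈ U), projDim (Z ∩ U)

/-- Quasi-projective variety in projective space: a Zariski locally closed subset. -/
def IsQuasiProjective {ι : Type} (Z : Set (ℙ ℂ (ι → ℂ))) : Prop :=
  @IsLocallyClosed _ (zariskiProj ι) Z

/-- Non-empty and connected in the Zariski topology. -/
def IsConnectedVariety {ι : Type} (Z : Set (ℙ ℂ (ι → ℂ))) : Prop :=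
  @IsConnected _ (zariskiProj ι) Z

/-- The linear space lying over the embedded projective tangent space of `Z` at `p`: the kernel of
the Jacobian at `p` of all homogeneous polynomials vanishing on `Z`. It contains the line `p`,
and for `Z` locally closed and `p ∈ Z` its dimension is one more than that of the
Zariski tangent space of `Z` at `p`. -/
def tangentCone {ι : Type} [Fintype ι] (Z : Set (ℙ ℂ (ι → ℂ))) (p : ℙ ℂ (ι → ℂ)) :
    Submodule ℂ (ι → ℂ) where
  carrier := {v | ∀ (m : ℕ) (f : MvPolynomial ι ℂ), f.IsHomogeneous m →
    (∀ q ∈ Z, MvPolynomial.eval q.rep f = 0) →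
      ∑ i, v i * MvPolynomial.eval p.rep (MvPolynomial.pderiv i f) = 0}
  add_mem' := by
    intro a b ha hb m f hf hZ
    simp only [Pi.add_apply, add_mul, Finset.sum_add_distrib, ha m f hf hZ, hb m f hf hZ, add_zero]
  zero_mem' := by
    intro m f hf hZ
    simp
  smul_mem' := by
    intro c a ha m f hf hZ
    simp only [Pi.smul_apply, smul_eq_mul, mul_assoc, ← Finset.mul_sum, ha m f hf hZ, mul_zero]

/-- Smoothness (Jacobian criterion): at each point of `Z` the dimension of the tangent space equals
the dimension of `Z` at that point. -/
def IsSmoothVariety {ι : Type} [Fintype ι] (Z : Set (ℙ ℂ (ι → ℂ))) : Prop :=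
  ∀ p ∈ Z, (Module.finrank ℂ (tangentCone Z p) : WithBot ℕ∞) = localDim Z p + 1

/-! ### The Grassmannian as a projective variety -/

/-- The Grassmannian of `k`-dimensional subspaces of `ℂⁿ`. -/
abbrev Gr (k n : ℕ) : Type := {X : Submodule ℂ (Fin n → ℂ) // Module.finrank ℂ X = k}

/-- The maximal minors of the `k × n` matrix with rows `b 0, …, b (k - 1)`. -/
def minors {k n : ℕ} (b : Fin k → Fin n → ℂ) : (Fin k ↪o Fin n) → ℂ :=
  fun s => (Matrix.of fun i j => b i (s j)).det

theorem minors_ne_zero {k n : ℕ} (b : Fin k → Fin n → ℂ) (hb : LinearIndependent ℂ b) :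
    minors b ≠ 0 := by
  classical
  set A : Matrix (Fin k) (Fin n) ℂ := Matrix.of b with hA
  have hr : A.rank = k := by
    have := LinearIndependent.rank_matrix (M := A) hb
    simpa using this
  obtain ⟨κ, a, ha, hspan, hli⟩ := exists_linearIndependent' ℂ A.col
  have : Finite κ := Finite.of_injective a ha
  have := Fintype.ofFinite κ
  have hκ : Fintype.card κ = k := by
    rw [← hr, Matrix.rank_eq_finrank_span_cols, ← hspan, finrank_span_eq_card hli]
  set T : Finset (Fin n) := Finset.univ.image a with hT
  have hTk : T.card = k := by
    rw [hT, Finset.card_image_of_injective _ ha, Finset.card_univ, hκ]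
  set s := T.orderEmbOfFin hTk with hs
  have hmem : ∀ i, ∃ x, a x = s i := by
    intro i
    have hi : s i ∈ T := T.orderEmbOfFin_mem hTk i
    rw [hT, Finset.mem_image] at hi
    obtain ⟨x, _, hx⟩ := hi
    exact ⟨x, hx⟩
  choose e he using hmem
  have hei : Function.Injective e := by
    intro i j hij
    apply s.injective
    rw [← he, ← he, hij]
  have hli2 := hli.comp e hei
  intro h0
  have hdet : (Matrix.of fun i j => b i (s j)).det = 0 := congrFun h0 s
  have hu : IsUnit (Matrix.of fun i j => b i (s j)) := by
    rw [← Matrix.linearIndependent_cols_iff_isUnit]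
    have hfun : (Matrix.of fun i j => b i (s j)).col = (A.col ∘ a) ∘ e := by
      funext i
      simp only [Function.comp, he]
      rfl
    rw [hfun]
    exact hli2
  rw [Matrix.isUnit_iff_isUnit_det, hdet] at hu
  simp at hu

/-- The Plücker embedding: `X` goes to the vector of maximal minors of the matrix of a basis
of `X`; another basis only changes this vector by a non-zero factor. -/
def plucker {k n : ℕ} (X : Gr k n) : ℙ ℂ ((Fin k ↪o Fin n) → ℂ) :=
  Projectivization.mk ℂ
    (minors fun i => (Module.finBasisOfFinrankEq ℂ X.1 X.2 i : Fin n → ℂ))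
    (minors_ne_zero _ ((Module.finBasisOfFinrankEq ℂ X.1 X.2).linearIndependent.map'
      X.1.subtype X.1.ker_subtype))

/-! ### Nilpotent orbits and the Spaltenstein variety -/

/-- `O_{(w - r, r)}`: the endomorphisms `t` of `ℂʷ` with `t² = 0` and rank `r`. -/
def orbit (w r : ℕ) : Set (Module.End ℂ (Fin w → ℂ)) :=
  {t | t ^ 2 = 0 ∧ Module.finrank ℂ (LinearMap.range t) = r}

/-- The dimension of `O_{(w - r, r)}` as a subvariety of the affine space of `w × w` matrices. -/
def orbitDim (w r : ℕ) : WithBot ℕ∞ :=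
  affineDim ((fun (t : Module.End ℂ (Fin w → ℂ)) (ij : Fin w × Fin w) =>
    LinearMap.toMatrix' t ij.1 ij.2) '' orbit w r)

/-- The two-step Spaltenstein variety of `t` as a set of points of the Grassmannian: the
`w₁`-dimensional `t`-stable subspaces `X` such that `t` has rank `r₁` on `X` and rank `r₂` on the
quotient by `X`. -/
def variety {n : ℕ} (t : Module.End ℂ (Fin n → ℂ)) (w₁ r₁ r₂ : ℕ) : Set (Gr w₁ n) :=
  {X | ∃ h : X.1 ≤ X.1.comap t,
    Module.finrank ℂ (LinearMap.range (t.restrict h)) = r₁ ∧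
    Module.finrank ℂ (LinearMap.range (X.1.mapQ X.1 t h)) = r₂}

end

end Spaltenstein

/-! Write V = ℂ^(w₁+w₂). The image of t on V/X is (im t + X)/X, so its rank is r - dim(X ∩ im t).
Membership thus means that X is stable, dim tX = r₁ and dim(X ∩ im t) = r - r₂ (`IsStable`,
`mem_variety_iff`). The inclusions tX ⊆ X ∩ im t ⊆ X ∩ ker t and (X ∩ ker t) + im t ⊆ ker t give
exactly the three inequalities (`IsStable.inequalities`), whence emptiness otherwise. Their slacks
are the numbers d, b, a below.

Complements along this filtration, together with lifts along t, form a basis in which t and X have a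
normal form depending only on numbers (`exists_adapted_equiv`). Square-zero maps of equal rank are
conjugate, so the normal form exists for the given t and the variety is non-empty. Any two points X,
Y are exchanged by an invertible g commuting with t; the pencil (1 - s)·id + s·g, restricted to the
s where it is invertible, joins X to Y, so the variety is connected.

For the local structure, subspaces in the big cell around X are graphs of matrices M. The conditions
kill some blocks of M, express one block polynomially in others, and leave the rest free
(`isStable_range_graphMap_iff`). Entries of M are ratios of Plücker coordinates in the adapted
basis, so the variety is covered by copies of one affine space (`LinearChart`). Local closedness,
smoothness and dimension follow formally from such charts. The orbits are charted by a factorization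
of square-zero matrices, giving dimension 2r(w - r) (`orbitDim_eq`). The dimension formula is then a
polynomial identity in a, b, d, r₁, r₂. -/

namespace Spaltenstein

open Topology TopologicalSpace Module

/-! ### Krull dimension is local and invariant under parametrization -/

section KrullDimension

variable {T P : Type*} [TopologicalSpace T] [TopologicalSpace P]

/-- Every member of a chain of irreducible closed sets contains the smallest one. For U around a
point of that one, intersecting with U keeps the chain strict, because irreducible closed sets
meeting U correspond to those of U. -/
theorem topologicalKrullDim_le_of_locally {d : WithBot ℕ∞}
    (h : ∀ x : T, ∃ U : Set T, IsOpen U ∧ x ∈ U ∧ topologicalKrullDim U ≤ d) :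
    topologicalKrullDim T ≤ d := by
  refine iSup_le fun p => ?_
  obtain ⟨x, hx⟩ := p.head.2.nonempty
  obtain ⟨U, hU, hxU, hd⟩ := h x
  have hle : ∀ i, p.head ≤ p i := fun i => p.head_le i
  let e := IrreducibleCloseds.orderIsoOfIsOpenEmbedding (Subtype.val : U → T)
    hU.isOpenEmbedding_subtypeVal
  let q : LTSeries {V : IrreducibleCloseds T | ((Subtype.val : U → T) ⁻¹' V).Nonempty} :=
    { length := p.length
      toFun := fun i => ⟨p i, ⟨⟨x, hxU⟩, hle i hx⟩⟩
      step := fun i => p.step i }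
  have hq : q.length = (q.map e.symm e.symm.strictMono).length := rfl
  refine le_trans ?_ hd
  change ((q.length : ℕ∞) : WithBot ℕ∞) ≤ _
  rw [hq]
  exact Order.LTSeries.length_le_krullDim _

theorem topologicalKrullDim_le_of_locally_inter {d : WithBot ℕ∞} {Z : Set P}
    (h : ∀ x ∈ Z, ∃ U : Set P, IsOpen U ∧ x ∈ U ∧ topologicalKrullDim ↥(Z ∩ U) ≤ d) :
    topologicalKrullDim Z ≤ d := by
  refine topologicalKrullDim_le_of_locally fun x => ?_
  obtain ⟨U, hU, hxU, hd⟩ := h x x.2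
  refine ⟨Subtype.val ⁻¹' U, hU.preimage continuous_subtype_val, hxU, le_trans ?_ hd⟩
  let f : ↥((Subtype.val : Z → P) ⁻¹' U) → ↥(Z ∩ U) := fun y => ⟨y.1.1, y.1.2, y.2⟩
  have hf : IsInducing f := by
    refine IsInducing.of_comp (g := Subtype.val) (f := f) ?_ continuous_subtype_val ?_
    · exact Continuous.subtype_mk (continuous_subtype_val.comp continuous_subtype_val) _
    · exact (IsInducing.subtypeVal (t := Z)).comp
        (IsInducing.subtypeVal (t := (Subtype.val : Z → P) ⁻¹' U))
  exact hf.topologicalKrullDim_le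

theorem topologicalKrullDim_mono {Z Z' : Set P} (h : Z ⊆ Z') :
    topologicalKrullDim Z ≤ topologicalKrullDim Z' :=
  (IsEmbedding.inclusion h).isInducing.topologicalKrullDim_le

theorem topologicalKrullDim_range_inter {f : T → P} (hf : IsInducing f)
    (hi : Function.Injective f) (U : Set P) :
    topologicalKrullDim ↥(Set.range f ∩ U) = topologicalKrullDim ↥(f ⁻¹' U) := by
  let g : ↥(f ⁻¹' U) → ↥(Set.range f ∩ U) := fun x => ⟨f x.1, ⟨x.1, rfl⟩, x.2⟩
  have hg : IsInducing g := by
    refine IsInducing.of_comp (g := Subtype.val) (f := g) ?_ continuous_subtype_val ?_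
    · exact Continuous.subtype_mk (hf.continuous.comp continuous_subtype_val) _
    · exact hf.comp IsInducing.subtypeVal
  refine (IsHomeomorph.topologicalKrullDim_eq g ?_).symm
  rw [isHomeomorph_iff_isEmbedding_surjective]
  refine ⟨⟨hg, fun x y hxy => ?_⟩, ?_⟩
  · exact Subtype.ext (hi (congrArg Subtype.val hxy))
  · rintro ⟨_, ⟨x, rfl⟩, hx⟩
    exact ⟨⟨x, hx⟩, rfl⟩

end KrullDimension

/-! ### Polynomial functions -/

/-- A function on affine space given by a polynomial. -/
def IsPoly {ι : Type} (f : (ι → ℂ) → ℂ) : Prop :=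
  ∃ p : MvPolynomial ι ℂ, ∀ x, f x = MvPolynomial.eval x p

namespace IsPoly

variable {ι κ : Type} {f g : (ι → ℂ) → ℂ}

theorem eval (p : MvPolynomial ι ℂ) : IsPoly fun x => MvPolynomial.eval x p := ⟨p, fun _ => rfl⟩

theorem const (c : ℂ) : IsPoly fun _ : ι → ℂ => c := ⟨MvPolynomial.C c, by simp⟩

theorem coord (i : ι) : IsPoly fun x : ι → ℂ => x i := ⟨MvPolynomial.X i, by simp⟩

theorem add (hf : IsPoly f) (hg : IsPoly g) : IsPoly fun x => f x + g x := by
  obtain ⟨p, hp⟩ := hf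
  obtain ⟨q, hq⟩ := hg
  exact ⟨p + q, by simp [hp, hq]⟩

theorem mul (hf : IsPoly f) (hg : IsPoly g) : IsPoly fun x => f x * g x := by
  obtain ⟨p, hp⟩ := hf
  obtain ⟨q, hq⟩ := hg
  exact ⟨p * q, by simp [hp, hq]⟩

theorem neg (hf : IsPoly f) : IsPoly fun x => -f x := by
  obtain ⟨p, hp⟩ := hf
  exact ⟨-p, by simp [hp]⟩

theorem sub (hf : IsPoly f) (hg : IsPoly g) : IsPoly fun x => f x - g x := by
  simpa [sub_eq_add_neg] using hf.add hg.neg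

theorem sum {α : Type*} (s : Finset α) {F : α → (ι → ℂ) → ℂ} (h : ∀ a, IsPoly (F a)) :
    IsPoly fun x => ∑ a ∈ s, F a x := by
  choose p hp using h
  exact ⟨∑ a ∈ s, p a, by simp [hp]⟩

theorem prod {α : Type*} (s : Finset α) {F : α → (ι → ℂ) → ℂ} (h : ∀ a, IsPoly (F a)) :
    IsPoly fun x => ∏ a ∈ s, F a x := by
  choose p hp using h
  exact ⟨∏ a ∈ s, p a, by simp [hp]⟩

theorem det {n : Type*} [Fintype n] [DecidableEq n] {A : (ι → ℂ) → Matrix n n ℂ}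
    (h : ∀ i j, IsPoly fun x => A x i j) : IsPoly fun x => (A x).det := by
  simp only [Matrix.det_apply']
  exact sum _ fun σ => (const _).mul (prod _ fun i => h _ _)

theorem comp {φ : (κ → ℂ) → ι → ℂ} (hf : IsPoly f) (hφ : ∀ i, IsPoly fun x => φ x i) :
    IsPoly fun x => f (φ x) := by
  obtain ⟨p, hp⟩ := hf
  choose q hq using hφ
  refine ⟨MvPolynomial.bind₁ q p, fun x => ?_⟩
  change f (φ x) = _
  rw [hp, ← MvPolynomial.coe_aeval_eq_eval, ← MvPolynomial.coe_aeval_eq_eval,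
    RingHom.coe_coe, RingHom.coe_coe, MvPolynomial.aeval_bind₁]
  congr 2
  funext i
  exact (hq i x).trans rfl

theorem linear [Fintype ι] (l : (ι → ℂ) →ₗ[ℂ] ℂ) : IsPoly fun x => l x := by
  classical
  have : (fun x : ι → ℂ => l x) = fun x => ∑ i, x i * l (Pi.single i 1) := by
    funext x
    conv_lhs => rw [← LinearMap.sum_single_apply (φ := fun _ : ι => ℂ) x, map_sum]
    refine Finset.sum_congr rfl fun i _ => ?_
    rw [← smul_eq_mul, ← map_smul]
    congr 1
    rw [← Pi.single_smul]
    simp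
  rw [this]
  exact sum _ fun i => (coord i).mul (const _)

end IsPoly

/-! ### The Zariski topology on affine space -/

section Affine

attribute [local instance] zariskiAffine

variable {ι κ : Type}

theorem IsPoly.isOpen {f : (ι → ℂ) → ℂ} (hf : IsPoly f) : IsOpen {x | f x ≠ 0} := by
  obtain ⟨p, hp⟩ := hf
  simp only [hp]
  exact isOpen_generateFrom_of_mem ⟨p, rfl⟩

theorem IsPoly.isClosed {f : (ι → ℂ) → ℂ} (hf : IsPoly f) : IsClosed {x | f x = 0} :=
  ⟨hf.isOpen⟩

theorem exists_poly_of_isOpen {U : Set (ι → ℂ)} (hU : IsOpen U) {x : ι → ℂ} (hx : x ∈ U) :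
    ∃ p : MvPolynomial ι ℂ, MvPolynomial.eval x p ≠ 0 ∧ {y | MvPolynomial.eval y p ≠ 0} ⊆ U := by
  induction hU with
  | basic s hs =>
    obtain ⟨p, rfl⟩ := hs
    exact ⟨p, hx, subset_rfl⟩
  | univ => exact ⟨1, by simp, Set.subset_univ _⟩
  | inter s t _ _ hs ht =>
    obtain ⟨p, hp, hps⟩ := hs hx.1
    obtain ⟨q, hq, hqt⟩ := ht hx.2
    refine ⟨p * q, by simp [hp, hq], fun y hy => ?_⟩
    simp only [map_mul, Set.mem_ofPred_eq, mul_ne_zero_iff] at hy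
    exact ⟨hps hy.1, hqt hy.2⟩
  | sUnion S _ ih =>
    obtain ⟨s, hs, hxs⟩ := hx
    obtain ⟨p, hp, hps⟩ := ih s hs hxs
    exact ⟨p, hp, hps.trans (Set.subset_sUnion_of_mem hs)⟩

theorem continuous_of_isPoly {φ : (κ → ℂ) → ι → ℂ} (hφ : ∀ i, IsPoly fun x => φ x i) :
    Continuous φ := by
  refine continuous_generateFrom_iff.2 ?_
  rintro _ ⟨p, rfl⟩
  exact ((IsPoly.eval p).comp hφ).isOpen

instance preirreducibleSpace_affine : PreirreducibleSpace (ι → ℂ) where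
  isPreirreducible_univ := by
    rintro U V hU hV ⟨x, -, hx⟩ ⟨y, -, hy⟩
    obtain ⟨p, hp, hpU⟩ := exists_poly_of_isOpen hU hx
    obtain ⟨q, hq, hqV⟩ := exists_poly_of_isOpen hV hy
    by_contra hcon
    have h0 : p * q = 0 := by
      refine MvPolynomial.funext fun z => ?_
      by_contra hz
      simp only [map_mul, map_zero, mul_eq_zero, not_or] at hz
      exact hcon ⟨z, trivial, hpU hz.1, hqV hz.2⟩
    rcases mul_eq_zero.1 h0 with h | h
    · exact hp (by simp [h])
    · exact hq (by simp [h])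

theorem isPreirreducible_of_isOpen {U : Set (ι → ℂ)} (hU : IsOpen U) : IsPreirreducible U :=
  (PreirreducibleSpace.isPreirreducible_univ).open_subset hU (Set.subset_univ _)

/-- Vanishing ideals of irreducible closed sets are prime and reverse inclusions strictly, so chains
of closed sets become chains of primes in the polynomial ring. -/
theorem topologicalKrullDim_affine_le [Finite ι] :
    topologicalKrullDim (ι → ℂ) ≤ (Nat.card ι : WithBot ℕ∞) := by
  have hprime : ∀ Z : IrreducibleCloseds (ι → ℂ),
      (MvPolynomial.vanishingIdeal ℂ (Z : Set (ι → ℂ))).IsPrime := by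
    intro Z
    refine ⟨?_, ?_⟩
    · obtain ⟨x, hx⟩ := Z.2.nonempty
      rw [Ne, Ideal.eq_top_iff_one, MvPolynomial.mem_vanishingIdeal_iff]
      intro h
      simpa using h x hx
    · intro p q hpq
      by_contra hcon
      simp only [not_or, MvPolynomial.mem_vanishingIdeal_iff, not_forall] at hcon
      obtain ⟨⟨x, hx, hxp⟩, ⟨y, hy, hyq⟩⟩ := hcon
      obtain ⟨z, hz, hzp, hzq⟩ := Z.2.isPreirreducible _ _ (IsPoly.eval p).isOpen
        (IsPoly.eval q).isOpen ⟨x, hx, hxp⟩ ⟨y, hy, hyq⟩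
      have := MvPolynomial.mem_vanishingIdeal_iff.1 hpq z hz
      simp only [map_mul, mul_eq_zero] at this
      exact this.elim hzp hzq
  let f : IrreducibleCloseds (ι → ℂ) → (PrimeSpectrum (MvPolynomial ι ℂ))ᵒᵈ :=
    fun Z => OrderDual.toDual ⟨_, hprime Z⟩
  have hle : ∀ Z W : IrreducibleCloseds (ι → ℂ), f Z ≤ f W → Z ≤ W := by
    intro Z W h x hx
    by_contra hxW
    obtain ⟨p, hp, hpW⟩ := exists_poly_of_isOpen W.3.isOpen_compl hxW
    have hpW' : p ∈ MvPolynomial.vanishingIdeal ℂ (W : Set (ι → ℂ)) := by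
      rw [MvPolynomial.mem_vanishingIdeal_iff]
      intro y hy
      by_contra hy0
      exact hpW hy0 hy
    have : p ∈ MvPolynomial.vanishingIdeal ℂ (Z : Set (ι → ℂ)) := h hpW'
    exact hp (MvPolynomial.mem_vanishingIdeal_iff.1 this x hx)
  have hmono : StrictMono f := by
    intro Z W hZW
    refine lt_of_le_not_ge ?_ fun h => hZW.not_ge (hle _ _ h)
    exact MvPolynomial.vanishingIdeal_anti_mono hZW.le
  refine (Order.krullDim_le_of_strictMono f hmono).trans ?_
  rw [Order.krullDim_orderDual]
  change ringKrullDim (MvPolynomial ι ℂ) ≤ _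
  rw [MvPolynomial.ringKrullDim_of_isNoetherianRing, ringKrullDim_eq_zero_of_field, zero_add]

/-- The chain is a flag of coordinate affine subspaces through a point x₀ of U, each cut with U. -/
theorem le_topologicalKrullDim_of_isOpen [Finite ι] {U : Set (ι → ℂ)} (hU : IsOpen U)
    (hne : U.Nonempty) : (Nat.card ι : WithBot ℕ∞) ≤ topologicalKrullDim U := by
  classical
  obtain ⟨x₀, hx₀⟩ := hne
  obtain ⟨e⟩ : Nonempty (ι ≃ Fin (Nat.card ι)) := ⟨Finite.equivFin ι⟩
  -- `ρ k` is a polynomial retraction of affine space onto the k-th member of the flag; it transfers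
  -- irreducibility from affine space to `L k`.
  let ρ : ℕ → (ι → ℂ) → ι → ℂ := fun k y i => if (e i : ℕ) < k then y i else x₀ i
  have hρ : ∀ k, Continuous (ρ k) := fun k => continuous_of_isPoly fun i => by
    by_cases h : (e i : ℕ) < k
    · simpa [ρ, h] using IsPoly.coord i
    · simpa [ρ, h] using IsPoly.const _
  let L : ℕ → Set U := fun k => {x | ∀ i, k ≤ (e i : ℕ) → x.1 i = x₀ i}
  have hLρ : ∀ k (x : U), x ∈ L k → ρ k x.1 = x.1 := by
    intro k x hx
    funext i
    by_cases h : (e i : ℕ) < k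
    · simp [ρ, h]
    · simpa [ρ, h] using (hx i (not_lt.1 h)).symm
  have hmem : ∀ k, (⟨x₀, hx₀⟩ : U) ∈ L k := fun k i _ => rfl
  have hLcl : ∀ k, IsClosed (L k) := by
    intro k
    have : L k = ⋂ i, ⋂ (_ : k ≤ (e i : ℕ)), Subtype.val ⁻¹' {x : ι → ℂ | x i - x₀ i = 0} := by
      ext x
      simp [L, sub_eq_zero]
    rw [this]
    exact isClosed_iInter fun i => isClosed_iInter fun _ =>
      (((IsPoly.coord i).sub (IsPoly.const _)).isClosed).preimage continuous_subtype_val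
  have hmeet : ∀ k (A : Set (ι → ℂ)), IsOpen A → ∀ x : U, x ∈ L k → x.1 ∈ A →
      (ρ k ⁻¹' (U ∩ A)).Nonempty ∧ IsOpen (ρ k ⁻¹' (U ∩ A)) := by
    intro k A hA x hx hxA
    refine ⟨⟨x.1, ?_⟩, (hU.inter hA).preimage (hρ k)⟩
    rw [Set.mem_preimage, hLρ k x hx]
    exact ⟨x.2, hxA⟩
  have hρL : ∀ k y (h : ρ k y ∈ U), (⟨ρ k y, h⟩ : U) ∈ L k := by
    intro k y h i hi
    simp [ρ, not_lt.2 hi]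
  have hLirr : ∀ k, IsIrreducible (L k) := by
    intro k
    refine ⟨⟨_, hmem k⟩, ?_⟩
    rintro _ _ ⟨A, hA, rfl⟩ ⟨B, hB, rfl⟩ ⟨x, hx, hxA⟩ ⟨y, hy, hyB⟩
    obtain ⟨h1, h1o⟩ := hmeet k A hA x hx hxA
    obtain ⟨h2, h2o⟩ := hmeet k B hB y hy hyB
    obtain ⟨z, -, hz1, hz2⟩ := PreirreducibleSpace.isPreirreducible_univ (X := ι → ℂ) _ _ h1o h2o
      (by simpa using h1) (by simpa using h2)
    exact ⟨⟨ρ k z, hz1.1⟩, hρL k z _, hz1.2, hz2.2⟩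
  have hstep : ∀ k < Nat.card ι, L k < L (k + 1) := by
    intro k hk
    -- If the two members agreed, coordinate i would equal x₀ i on the non-empty open preimage of U
    -- under `ρ (k + 1)`, which must meet the open set where it differs from x₀ i.
    refine lt_of_le_not_ge (fun x hx i hi => hx i (by omega)) fun hcon => ?_
    let i := e.symm ⟨k, hk⟩
    have hei : (e i : ℕ) = k := by simp [i]
    obtain ⟨h1, h1o⟩ := hmeet (k + 1) Set.univ isOpen_univ ⟨x₀, hx₀⟩ (hmem _) trivial
    have h2 : IsOpen {x : ι → ℂ | x i - x₀ i ≠ 0} :=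
      ((IsPoly.coord i).sub (IsPoly.const _)).isOpen
    have h3 : {x : ι → ℂ | x i - x₀ i ≠ 0}.Nonempty := ⟨fun j => x₀ j + 1, by simp⟩
    obtain ⟨z, -, hz1, hz2⟩ := PreirreducibleSpace.isPreirreducible_univ (X := ι → ℂ) _ _ h1o h2
      (by simpa using h1) (by simpa using h3)
    have := hcon (hρL (k + 1) z hz1.1) i hei.ge
    refine hz2 ?_
    simp only [ρ, hei, Nat.lt_succ_self, if_true] at this
    rw [this, sub_self]
  let q : LTSeries (IrreducibleCloseds U) :=
    { length := Nat.card ι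
      toFun := fun k => ⟨L k, hLirr k, hLcl k⟩
      step := fun k => hstep k k.2 }
  exact Order.LTSeries.length_le_krullDim q

theorem topologicalKrullDim_of_isOpen [Finite ι] {U : Set (ι → ℂ)} (hU : IsOpen U)
    (hne : U.Nonempty) : topologicalKrullDim U = (Nat.card ι : WithBot ℕ∞) :=
  le_antisymm ((topologicalKrullDim_subspace_le _ U).trans topologicalKrullDim_affine_le)
    (le_topologicalKrullDim_of_isOpen hU hne)

end Affine

end Spaltenstein

namespace Spaltenstein

open Topology TopologicalSpace Module

/-! ### Homogeneous polynomials, clearing denominators, derivatives along curves -/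

section Homogeneous

variable {ι : Type}

theorem eval_smul_of_isHomogeneous {f : MvPolynomial ι ℂ} {m : ℕ} (hf : f.IsHomogeneous m)
    (c : ℂ) (x : ι → ℂ) :
    MvPolynomial.eval (c • x) f = c ^ m * MvPolynomial.eval x f := by
  rw [MvPolynomial.eval_eq, MvPolynomial.eval_eq, Finset.mul_sum]
  refine Finset.sum_congr rfl fun d hd => ?_
  have hm : ∑ i ∈ d.support, d i = m := by
    have := hf (MvPolynomial.mem_support_iff.1 hd)
    rw [Finsupp.weight_apply, Finsupp.sum] at this
    simpa using this
  simp only [Pi.smul_apply, smul_eq_mul, mul_pow, Finset.prod_mul_distrib,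
    Finset.prod_pow_eq_pow_sum, hm]
  ring

/-- The linear polynomial of a linear form. -/
noncomputable def linPoly [Fintype ι] (l : Dual ℂ (ι → ℂ)) : MvPolynomial ι ℂ := by
  classical
  exact ∑ i, MvPolynomial.C (l (Pi.single i 1)) * MvPolynomial.X i

theorem dual_apply_eq_sum [Fintype ι] [DecidableEq ι] (l : Dual ℂ (ι → ℂ)) (x : ι → ℂ) :
    l x = ∑ i, l (Pi.single i 1) * x i := by
  conv_lhs => rw [pi_eq_sum_univ' x, map_sum]
  refine Finset.sum_congr rfl fun i _ => ?_
  rw [map_smul, smul_eq_mul, mul_comm]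

@[simp] theorem eval_linPoly [Fintype ι] (l : Dual ℂ (ι → ℂ)) (x : ι → ℂ) :
    MvPolynomial.eval x (linPoly l) = l x := by
  classical
  rw [dual_apply_eq_sum l x, linPoly, map_sum]
  refine Finset.sum_congr rfl fun i _ => ?_
  rw [map_mul, MvPolynomial.eval_C, MvPolynomial.eval_X]

theorem isHomogeneous_linPoly [Fintype ι] (l : Dual ℂ (ι → ℂ)) : (linPoly l).IsHomogeneous 1 :=
  MvPolynomial.IsHomogeneous.sum _ _ _ fun i _ => by
    simpa using (MvPolynomial.isHomogeneous_C ι _).mul (MvPolynomial.isHomogeneous_X ℂ i)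

theorem exists_homogenization [Fintype ι] {F : Type} (l₀ : Dual ℂ (ι → ℂ))
    (l : F → Dual ℂ (ι → ℂ)) (p : MvPolynomial F ℂ) :
    ∃ (m : ℕ) (H : MvPolynomial ι ℂ), H.IsHomogeneous m ∧ ∀ y, l₀ y ≠ 0 →
      MvPolynomial.eval y H = l₀ y ^ m * MvPolynomial.eval (fun j => l j y / l₀ y) p := by
  induction p using MvPolynomial.induction_on with
  | C a => exact ⟨0, MvPolynomial.C a, MvPolynomial.isHomogeneous_C _ _, by simp⟩
  | add p q hp hq =>
    obtain ⟨m, H, hH, h⟩ := hp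
    obtain ⟨n, K, hK, k⟩ := hq
    refine ⟨m + n, linPoly l₀ ^ n * H + linPoly l₀ ^ m * K, ?_, fun y hy => ?_⟩
    · refine MvPolynomial.IsHomogeneous.add ?_ ?_
      · have := ((isHomogeneous_linPoly l₀).pow n).mul hH
        rwa [one_mul, add_comm] at this
      · have := ((isHomogeneous_linPoly l₀).pow m).mul hK
        rwa [one_mul] at this
    · simp only [map_add, map_mul, map_pow, eval_linPoly, h y hy, k y hy]
      ring
  | mul_X p j hp =>
    obtain ⟨m, H, hH, h⟩ := hp
    refine ⟨m + 1, H * linPoly (l j), hH.mul (isHomogeneous_linPoly _), fun y hy => ?_⟩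
    simp only [map_mul, eval_linPoly, h y hy, MvPolynomial.eval_X]
    field_simp
    ring

/-- The chain rule, which links the formal Jacobian in `tangentCone` to velocities of curves. -/
theorem hasDerivAt_eval [Fintype ι] (f : MvPolynomial ι ℂ) {γ : ℂ → ι → ℂ} {γ' : ι → ℂ} {s : ℂ}
    (h : ∀ i, HasDerivAt (fun u => γ u i) (γ' i) s) :
    HasDerivAt (fun u => MvPolynomial.eval (γ u) f)
      (∑ i, γ' i * MvPolynomial.eval (γ s) (MvPolynomial.pderiv i f)) s := by
  classical
  induction f using MvPolynomial.induction_on with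
  | C a => simpa using hasDerivAt_const s a
  | add p q hp hq =>
    simp only [map_add, mul_add, Finset.sum_add_distrib]
    exact hp.add hq
  | mul_X p j hp =>
    simp only [map_mul, MvPolynomial.eval_X]
    refine (hp.fun_mul (h j)).congr_deriv ?_
    simp only [Derivation.leibniz, MvPolynomial.pderiv_X, smul_eq_mul, map_add, map_mul,
      MvPolynomial.eval_X, mul_add, Finset.sum_add_distrib, Finset.sum_mul]
    rw [add_comm]
    congr 1
    · rw [Finset.sum_eq_single j]
      · simp [mul_comm]
      · intro i _ hij
        simp [hij.symm]
      · simp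
    · exact Finset.sum_congr rfl fun i _ => by ring

theorem hasDerivAt_dual [Fintype ι] (l : Dual ℂ (ι → ℂ)) {γ : ℂ → ι → ℂ} {γ' : ι → ℂ} {s : ℂ}
    (h : ∀ i, HasDerivAt (fun u => γ u i) (γ' i) s) :
    HasDerivAt (fun u => l (γ u)) (l γ') s := by
  classical
  have hl : (fun u => l (γ u)) = fun u => ∑ i, l (Pi.single i 1) * γ u i :=
    funext fun u => dual_apply_eq_sum l (γ u)
  rw [hl, dual_apply_eq_sum l γ']
  exact HasDerivAt.fun_sum fun i _ => (h i).const_mul _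

end Homogeneous

/-! ### The Zariski topology on projective space -/

section Projective

attribute [local instance] zariskiAffine zariskiProj

variable {ι : Type}

theorem eval_rep_mk_ne_zero_iff {f : MvPolynomial ι ℂ} {m : ℕ} (hf : f.IsHomogeneous m)
    {v : ι → ℂ} (hv : v ≠ 0) :
    MvPolynomial.eval (Projectivization.mk ℂ v hv).rep f ≠ 0 ↔ MvPolynomial.eval v f ≠ 0 := by
  obtain ⟨a, ha⟩ := Projectivization.exists_smul_eq_mk_rep ℂ v hv
  rw [← ha, Units.smul_def, eval_smul_of_isHomogeneous hf]
  simp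

theorem dual_rep_mk_ne_zero_iff (l : Dual ℂ (ι → ℂ)) {v : ι → ℂ} (hv : v ≠ 0) :
    l (Projectivization.mk ℂ v hv).rep ≠ 0 ↔ l v ≠ 0 := by
  obtain ⟨a, ha⟩ := Projectivization.exists_smul_eq_mk_rep ℂ v hv
  rw [← ha, Units.smul_def, map_smul]
  simp

theorem isOpen_eval_ne_zero {f : MvPolynomial ι ℂ} {m : ℕ} (hf : f.IsHomogeneous m) :
    IsOpen {p : ℙ ℂ (ι → ℂ) | MvPolynomial.eval p.rep f ≠ 0} :=
  isOpen_generateFrom_of_mem ⟨m, f, hf, rfl⟩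

theorem isClosed_eval_eq_zero {f : MvPolynomial ι ℂ} {m : ℕ} (hf : f.IsHomogeneous m) :
    IsClosed {p : ℙ ℂ (ι → ℂ) | MvPolynomial.eval p.rep f = 0} :=
  ⟨isOpen_eval_ne_zero hf⟩

theorem isOpen_dual_ne_zero [Fintype ι] (l : Dual ℂ (ι → ℂ)) :
    IsOpen {p : ℙ ℂ (ι → ℂ) | l p.rep ≠ 0} := by
  simpa using isOpen_eval_ne_zero (isHomogeneous_linPoly l)

theorem continuous_mk {T : Type*} [TopologicalSpace T] {v : T → ι → ℂ} (h0 : ∀ x, v x ≠ 0)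
    (hv : Continuous v) : Continuous fun x => Projectivization.mk ℂ (v x) (h0 x) := by
  refine continuous_generateFrom_iff.2 ?_
  rintro _ ⟨m, f, hf, rfl⟩
  simp only [Set.preimage_ofPred_eq, eval_rep_mk_ne_zero_iff hf]
  exact (IsPoly.eval f).isOpen.preimage hv

/-- A chart of a subset `Z` of projective space on the principal open set of a linear form
`denom`: there `Z` is parametrized by polynomials on the affine space with coordinates `F`, and
the parameters are recovered as quotients of linear forms by `denom`. -/
structure LinearChart [Fintype ι] (Z : Set (ℙ ℂ (ι → ℂ))) (F : Type) where
  param : (F → ℂ) → ι → ℂ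
  isPoly_param : ∀ i, IsPoly fun x => param x i
  denom : Dual ℂ (ι → ℂ)
  coord : F → Dual ℂ (ι → ℂ)
  denom_param : ∀ x, denom (param x) = 1
  coord_param : ∀ x j, coord j (param x) = x j
  mk_mem : ∀ x h, Projectivization.mk ℂ (param x) h ∈ Z
  exists_param : ∀ q ∈ Z, denom q.rep ≠ 0 → ∃ (x : F → ℂ) (c : ℂ), q.rep = c • param x

namespace LinearChart

variable [Fintype ι] {Z : Set (ℙ ℂ (ι → ℂ))} {F : Type} (χ : LinearChart Z F)

theorem param_ne_zero (x : F → ℂ) : χ.param x ≠ 0 := by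
  intro h
  simpa [h] using χ.denom_param x

/-- The principal open set on which a chart is defined. -/
def source : Set (ℙ ℂ (ι → ℂ)) := {p | χ.denom p.rep ≠ 0}

theorem isOpen_source : IsOpen χ.source := isOpen_dual_ne_zero _

/-- The parametrization of `Z` given by a chart. -/
noncomputable def toProj (x : F → ℂ) : ℙ ℂ (ι → ℂ) := Projectivization.mk ℂ (χ.param x) (χ.param_ne_zero x)

theorem range_toProj : Set.range χ.toProj = Z ∩ χ.source := by
  ext q
  constructor
  · rintro ⟨x, rfl⟩
    refine ⟨χ.mk_mem _ _, ?_⟩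
    exact (dual_rep_mk_ne_zero_iff _ _).2 (by simp [χ.denom_param])
  · rintro ⟨hq, hs⟩
    obtain ⟨x, c, hc⟩ := χ.exists_param q hq hs
    refine ⟨x, ?_⟩
    rw [← q.mk_rep]
    exact ((Projectivization.mk_eq_mk_iff' ℂ _ _ _ _).2 ⟨c, hc.symm⟩).symm

theorem injective_toProj : Function.Injective χ.toProj := by
  intro x y h
  obtain ⟨c, hc⟩ := (Projectivization.mk_eq_mk_iff' ℂ _ _ _ _).1 h
  have h1 : c = 1 := by
    have := congrArg χ.denom hc
    simpa [χ.denom_param] using this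
  funext j
  have := congrArg (χ.coord j) hc
  simpa [χ.coord_param, h1] using this.symm

/-- Chart coordinates are ratios of linear forms. Homogenizing a polynomial in them gives a
projective open set with the same trace, so no affine open set is lost. -/
theorem isInducing_toProj : IsInducing χ.toProj := by
  have hcont : Continuous χ.toProj :=
    continuous_mk χ.param_ne_zero (continuous_of_isPoly χ.isPoly_param)
  refine ⟨le_antisymm hcont.le_induced (le_generateFrom ?_)⟩
  rintro _ ⟨p, rfl⟩
  obtain ⟨m, H, hH, h⟩ := exists_homogenization χ.denom χ.coord p
  refine isOpen_induced_iff.2 ⟨_, isOpen_eval_ne_zero hH, ?_⟩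
  ext x
  simp only [Set.preimage_ofPred_eq, toProj, eval_rep_mk_ne_zero_iff hH]
  rw [Set.mem_ofPred_eq, Set.mem_ofPred_eq, h _ (by simp [χ.denom_param])]
  simp [χ.denom_param, χ.coord_param]

theorem topologicalKrullDim_inter [Finite F] {U : Set (ℙ ℂ (ι → ℂ))} (hU : IsOpen U)
    (hne : (Z ∩ χ.source ∩ U).Nonempty) :
    topologicalKrullDim ↥(Z ∩ χ.source ∩ U) = (Nat.card F : WithBot ℕ∞) := by
  rw [← χ.range_toProj] at hne ⊢
  rw [topologicalKrullDim_range_inter χ.isInducing_toProj χ.injective_toProj]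
  refine topologicalKrullDim_of_isOpen (hU.preimage χ.isInducing_toProj.continuous) ?_
  obtain ⟨_, ⟨x, rfl⟩, hx⟩ := hne
  exact ⟨x, hx⟩

/-- A homogeneous form of the equation "i-th coordinate = `param` of the chart coordinates". These
forms cut out Z inside the chart. -/
theorem exists_equation (i : ι) : ∃ (m : ℕ) (E : MvPolynomial ι ℂ), E.IsHomogeneous m ∧
    (∀ y, χ.denom y = 0 → MvPolynomial.eval y E = 0) ∧
    ∀ y, χ.denom y ≠ 0 → MvPolynomial.eval y E = χ.denom y ^ m *
      (y i / χ.denom y - χ.param (fun j => χ.coord j y / χ.denom y) i) := by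
  obtain ⟨p, hp⟩ := χ.isPoly_param i
  obtain ⟨m, H, hH, h⟩ := exists_homogenization χ.denom χ.coord p
  -- The extra factor `denom` makes the form vanish on the hyperplane `denom = 0`, hence on all of Z
  -- and not just on the chart.
  refine ⟨m + 2, linPoly χ.denom * (linPoly χ.denom ^ m * MvPolynomial.X i - linPoly χ.denom * H),
    ?_, fun y hy => by simp [hy], fun y hy => ?_⟩
  · have h1 := ((isHomogeneous_linPoly χ.denom).pow m).mul (MvPolynomial.isHomogeneous_X ℂ i)
    have h2 := (isHomogeneous_linPoly χ.denom).mul hH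
    rw [one_mul] at h1
    rw [add_comm] at h2
    have := (isHomogeneous_linPoly χ.denom).mul (h1.sub h2)
    rwa [show 1 + (m + 1) = m + 2 by ring] at this
  · simp only [map_mul, map_sub, map_pow, eval_linPoly, MvPolynomial.eval_X, h y hy, hp]
    field_simp
    ring

theorem coord_div_denom {c : ℂ} (hc : c ≠ 0) (x : F → ℂ) :
    (fun j => χ.coord j (c • χ.param x) / χ.denom (c • χ.param x)) = x := by
  funext j
  rw [map_smul, map_smul, χ.coord_param, χ.denom_param, smul_eq_mul, smul_eq_mul, mul_one,
    mul_div_cancel_left₀ _ hc]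

theorem eval_equation_eq_zero {i : ι} {m : ℕ} {E : MvPolynomial ι ℂ}
    (h0 : ∀ y, χ.denom y = 0 → MvPolynomial.eval y E = 0)
    (h1 : ∀ y, χ.denom y ≠ 0 → MvPolynomial.eval y E = χ.denom y ^ m *
      (y i / χ.denom y - χ.param (fun j => χ.coord j y / χ.denom y) i))
    {q : ℙ ℂ (ι → ℂ)} (hq : q ∈ Z) : MvPolynomial.eval q.rep E = 0 := by
  by_cases hd : χ.denom q.rep = 0
  · exact h0 _ hd
  · obtain ⟨x, c, hc⟩ := χ.exists_param q hq hd
    have hc0 : c ≠ 0 := by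
      rintro rfl
      exact hd (by simp [hc])
    rw [h1 _ hd, hc, χ.coord_div_denom hc0, map_smul, χ.denom_param]
    simp [hc0]

/-- The chart equations vanish on Z, hence on its closure; where `denom` is non-zero they force a
point to be parametrized. -/
theorem source_inter_closure_subset : χ.source ∩ closure Z ⊆ Z := by
  rintro q ⟨hs, hq⟩
  have hval : ∀ i, q.rep i / χ.denom q.rep =
      χ.param (fun j => χ.coord j q.rep / χ.denom q.rep) i := by
    intro i
    obtain ⟨m, E, hE, h0, h1⟩ := χ.exists_equation i
    have hqE : q ∈ {p : ℙ ℂ (ι → ℂ) | MvPolynomial.eval p.rep E = 0} :=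
      closure_minimal (fun p hp => χ.eval_equation_eq_zero h0 h1 hp)
        (isClosed_eval_eq_zero hE) hq
    have := h1 _ hs
    rw [show MvPolynomial.eval q.rep E = 0 from hqE] at this
    rcases mul_eq_zero.1 this.symm with h | h
    · exact absurd (eq_zero_of_pow_eq_zero h) hs
    · exact sub_eq_zero.1 h
  have : q = χ.toProj (fun j => χ.coord j q.rep / χ.denom q.rep) := by
    rw [← q.mk_rep]
    refine (Projectivization.mk_eq_mk_iff' ℂ _ _ _ _).2 ⟨χ.denom q.rep, ?_⟩
    funext i
    rw [Pi.smul_apply, q.mk_rep, ← hval, smul_eq_mul, mul_div_cancel₀ _ hs]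
  rw [this]
  exact χ.mk_mem _ _

/-- The linear forms `denom` and `coord` identify the tangent space of the cone with ℂ × (F → ℂ);
the additional dimension is the line p itself. -/
theorem finrank_tangentCone [Fintype F] {p : ℙ ℂ (ι → ℂ)} (hp : p ∈ Z) (hs : p ∈ χ.source) :
    finrank ℂ (tangentCone Z p) = Fintype.card F + 1 := by
  obtain ⟨x₀, c, hc⟩ := χ.exists_param p hp hs
  have hd : χ.denom p.rep = c := by rw [hc, map_smul, χ.denom_param, smul_eq_mul, mul_one]
  have hc0 : c ≠ 0 := hd ▸ hs
  let L : tangentCone Z p →ₗ[ℂ] ℂ × (F → ℂ) :=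
    (χ.denom.prod (LinearMap.pi χ.coord)).comp (tangentCone Z p).subtype
  have hinj : Function.Injective L := by
    refine (injective_iff_map_eq_zero L).2 ?_
    rintro ⟨v, hv⟩ h0
    have hv0 : χ.denom v = 0 := congrArg Prod.fst h0
    have hvj : ∀ j, χ.coord j v = 0 := fun j => congrFun (congrArg Prod.snd h0) j
    refine Subtype.ext (funext fun i => ?_)
    obtain ⟨m, E, hE, hE0, hE1⟩ := χ.exists_equation i
    have hz := hv m E hE fun q hq => χ.eval_equation_eq_zero hE0 hE1 hq
    -- Moving along v changes neither `denom` nor any `coord`, so equation i is affine in u with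
    -- slope a non-zero multiple of v i. Tangency makes that slope zero.
    have hγ : ∀ i, HasDerivAt (fun u : ℂ => (p.rep + u • v) i) (v i) 0 := fun i => by
      simpa using ((hasDerivAt_id (0 : ℂ)).mul_const (v i)).const_add (p.rep i)
    have h1 := hasDerivAt_eval E hγ
    simp only [zero_smul, add_zero, hz] at h1
    have h2 : (fun u : ℂ => MvPolynomial.eval (p.rep + u • v) E) = fun u => c ^ m *
        ((p.rep i + u * v i) / c - χ.param (fun j => χ.coord j p.rep / c) i) := by
      funext u
      have hdu : χ.denom (p.rep + u • v) = c := by simp [hv0, hd]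
      rw [hE1 _ (by rw [hdu]; exact hc0), hdu]
      simp [hvj]
    rw [h2] at h1
    have h3 : HasDerivAt (fun u : ℂ => c ^ m *
        ((p.rep i + u * v i) / c - χ.param (fun j => χ.coord j p.rep / c) i))
        (c ^ m * (v i / c)) 0 := by
      have := (((((hasDerivAt_id (0 : ℂ)).mul_const (v i)).const_add (p.rep i)).div_const
        c).sub_const (χ.param (fun j => χ.coord j p.rep / c) i)).const_mul (c ^ m)
      simpa using this
    have h4 := h1.unique h3
    have : v i = 0 := by
      by_contra hvi
      exact (mul_ne_zero (pow_ne_zero m hc0) (div_ne_zero hvi hc0)) h4.symm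
    simpa using this
  have hsurj : Function.Surjective L := by
    rintro ⟨a, u⟩
    -- With this w the curve (c + s a) · param(x₀ + s w) in the cone over Z has `denom`-velocity a
    -- and `coord`-velocity a x₀ + c w = u.
    let w : F → ℂ := fun j => (u j - a * x₀ j) / c
    choose P hP using χ.isPoly_param
    let γ : ℂ → ι → ℂ := fun s => (c + s * a) • χ.param (fun j => x₀ j + s * w j)
    have hbase : ∀ j, HasDerivAt (fun s : ℂ => x₀ j + s * w j) (w j) 0 := fun j => by
      simpa using ((hasDerivAt_id (0 : ℂ)).mul_const (w j)).const_add (x₀ j)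
    have hfac : HasDerivAt (fun s : ℂ => c + s * a) a 0 := by
      simpa using ((hasDerivAt_id (0 : ℂ)).mul_const a).const_add c
    have hγ0 : γ 0 = p.rep := by simp [γ, hc]
    let γ' : ι → ℂ := fun i => a * MvPolynomial.eval x₀ (P i) +
      c * ∑ j, w j * MvPolynomial.eval x₀ (MvPolynomial.pderiv j (P i))
    have hγ : ∀ i, HasDerivAt (fun s => γ s i) (γ' i) 0 := fun i => by
      have h1 := hfac.fun_mul (hasDerivAt_eval (P i) hbase)
      simp only [zero_mul, add_zero] at h1
      have h2 : (fun s => γ s i) = fun s => (c + s * a) *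
          MvPolynomial.eval (fun j => x₀ j + s * w j) (P i) := by
        funext s
        exact congrArg ((c + s * a) * ·) (hP i _)
      rw [h2]
      exact h1
    refine ⟨⟨γ', ?_⟩, ?_⟩
    · intro m f hf hZ
      have h1 := hasDerivAt_eval f hγ
      have h2 : (fun s => MvPolynomial.eval (γ s) f) = fun _ => 0 := by
        funext s
        have h3 := hZ _ (χ.mk_mem (fun j => x₀ j + s * w j) (χ.param_ne_zero _))
        have h4 : MvPolynomial.eval (χ.param fun j => x₀ j + s * w j) f = 0 := by
          by_contra h
          exact (eval_rep_mk_ne_zero_iff hf _).2 h h3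
        simp only [γ, eval_smul_of_isHomogeneous hf, h4, mul_zero]
      rw [h2] at h1
      simpa only [hγ0] using h1.unique (hasDerivAt_const _ _)
    · refine Prod.ext ?_ (funext fun j => ?_)
      · have h1 := hasDerivAt_dual χ.denom hγ
        have h2 : (fun s => χ.denom (γ s)) = fun s => c + s * a := by
          funext s
          simp [γ, χ.denom_param]
        rw [h2] at h1
        exact h1.unique hfac
      · have h1 := hasDerivAt_dual (χ.coord j) hγ
        have h2 : (fun s => χ.coord j (γ s)) = fun s => (c + s * a) * (x₀ j + s * w j) := by
          funext s
          simp [γ, χ.coord_param]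
        rw [h2] at h1
        have h3 := h1.unique (hfac.mul (hbase j))
        change χ.coord j γ' = u j
        rw [h3]
        simp only [w]
        field_simp
        ring
  rw [(LinearEquiv.ofBijective L ⟨hinj, hsurj⟩).finrank_eq]
  simp [add_comm]

end LinearChart

/-! ### Consequences of a covering by charts -/

section Charted

variable [Fintype ι] {Z : Set (ℙ ℂ (ι → ℂ))} {F : Type}

theorem isQuasiProjective_of_charts
    (h : ∀ p ∈ Z, ∃ χ : LinearChart Z F, p ∈ χ.source) : IsQuasiProjective Z :=
  ((isLocallyClosed_tfae Z).out 0 3).2 fun p hp => by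
    obtain ⟨χ, hχ⟩ := h p hp
    exact ⟨χ.source, hχ, χ.isOpen_source, χ.source_inter_closure_subset⟩

theorem projDim_of_charts [Fintype F]
    (h : ∀ p ∈ Z, ∃ χ : LinearChart Z F, p ∈ χ.source) (hne : Z.Nonempty) :
    projDim Z = (Fintype.card F : WithBot ℕ∞) := by
  rw [← Nat.card_eq_fintype_card]
  have key : ∀ p (hp : p ∈ Z), ∃ χ : LinearChart Z F, p ∈ χ.source ∧
      topologicalKrullDim ↥(Z ∩ χ.source) = (Nat.card F : WithBot ℕ∞) := by
    intro p hp
    obtain ⟨χ, hχ⟩ := h p hp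
    have := χ.topologicalKrullDim_inter isOpen_univ ⟨p, ⟨hp, hχ⟩, trivial⟩
    rw [Set.inter_univ] at this
    exact ⟨χ, hχ, this⟩
  refine le_antisymm ?_ ?_
  · refine topologicalKrullDim_le_of_locally_inter fun p hp => ?_
    obtain ⟨χ, hχ, hd⟩ := key p hp
    exact ⟨χ.source, χ.isOpen_source, hχ, hd.le⟩
  · obtain ⟨p, hp⟩ := hne
    obtain ⟨χ, hχ, hd⟩ := key p hp
    rw [← hd]
    exact topologicalKrullDim_mono Set.inter_subset_left

/-- Every non-empty open part of a chart already has full dimension, so the infimum defining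
`localDim` is the number of coordinates. -/
theorem isSmoothVariety_of_charts [Fintype F]
    (h : ∀ p ∈ Z, ∃ χ : LinearChart Z F, p ∈ χ.source) : IsSmoothVariety Z := by
  intro p hp
  obtain ⟨χ, hχ⟩ := h p hp
  have hloc : localDim Z p = (Fintype.card F : WithBot ℕ∞) := by
    rw [← Nat.card_eq_fintype_card]
    refine le_antisymm ?_ ?_
    · refine iInf₂_le_of_le χ.source ⟨χ.isOpen_source, hχ⟩ ?_
      have := χ.topologicalKrullDim_inter isOpen_univ ⟨p, ⟨hp, hχ⟩, trivial⟩
      rw [Set.inter_univ] at this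
      exact this.le
    · refine le_iInf₂ fun U hU => ?_
      have := χ.topologicalKrullDim_inter hU.1 ⟨p, ⟨hp, hχ⟩, hU.2⟩
      rw [← this]
      exact topologicalKrullDim_mono fun q hq => ⟨hq.1.1, hq.2⟩
  rw [χ.finrank_tangentCone hp hχ, hloc]
  rfl

end Charted

end Projective

end Spaltenstein

namespace Spaltenstein

open Module

/-! ### The Plücker embedding -/

section Plucker

variable {k n : ℕ}

/-- An alternating form factors through the exterior power, whose standard coordinates are the
minors. Hence minors taken in any other basis of ℂⁿ are linear forms in the Plücker coordinates. -/
theorem exists_dual_minors (f : (Fin n → ℂ) [⋀^Fin k]→ₗ[ℂ] ℂ) :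
    ∃ l : Dual ℂ ((Fin k ↪o Fin n) → ℂ), ∀ b, l (minors b) = f b := by
  let B := (Pi.basisFun ℂ (Fin n)).exteriorPower k
  let g := exteriorPower.alternatingMapLinearEquiv f
  refine ⟨∑ s, g (B s) • LinearMap.proj (Set.powersetCard.ofFinEmbEquiv.symm s), fun b => ?_⟩
  have h1 : f b = g (exteriorPower.ιMulti ℂ k b) :=
    (exteriorPower.alternatingMapLinearEquiv_apply_ιMulti f b).symm
  rw [h1]
  conv_rhs => rw [← B.sum_repr (exteriorPower.ιMulti ℂ k b), map_sum]
  rw [LinearMap.sum_apply]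
  refine Finset.sum_congr rfl fun s _ => ?_
  rw [map_smul, exteriorPower.basis_repr_apply, exteriorPower.ιMultiDual_apply_ιMulti,
    LinearMap.smul_apply, smul_eq_mul, smul_eq_mul, mul_comm]
  congr 1

theorem minors_eq_det_smul {b b' : Fin k → Fin n → ℂ} (A : Matrix (Fin k) (Fin k) ℂ)
    (h : ∀ i, b i = ∑ j, A i j • b' j) : minors b = A.det • minors b' := by
  funext s
  rw [Pi.smul_apply, smul_eq_mul, minors, minors, ← Matrix.det_mul]
  congr 1
  ext i j
  simp [h, Matrix.mul_apply]

theorem plucker_eq_mk (X : Gr k n) {b : Fin k → Fin n → ℂ} (hb : LinearIndependent ℂ b)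
    (hX : Submodule.span ℂ (Set.range b) = X.1) :
    plucker X = Projectivization.mk ℂ (minors b) (minors_ne_zero b hb) := by
  rw [plucker, Projectivization.mk_eq_mk_iff']
  have h : ∀ i, ∃ c : Fin k → ℂ,
      ∑ j, c j • b j = (finBasisOfFinrankEq ℂ X.1 X.2 i : Fin n → ℂ) := fun i =>
    (Submodule.mem_span_range_iff_exists_fun ℂ).1
      (hX.symm ▸ (finBasisOfFinrankEq ℂ X.1 X.2 i).2 :
        (finBasisOfFinrankEq ℂ X.1 X.2 i : Fin n → ℂ) ∈ Submodule.span ℂ (Set.range b))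
  choose A hA using h
  exact ⟨(Matrix.of A).det, (minors_eq_det_smul (Matrix.of A) fun i => (hA i).symm).symm⟩

end Plucker

/-! ### Dimensions of stable subspaces -/

section Dimension

variable {V W : Type*} [AddCommGroup V] [Module ℂ V] [AddCommGroup W] [Module ℂ W]

theorem finrank_map_add_finrank_inf_ker [FiniteDimensional ℂ V] (f : V →ₗ[ℂ] W)
    (X : Submodule ℂ V) :
    finrank ℂ (X.map f) + finrank ℂ ↥(X ⊓ LinearMap.ker f) = finrank ℂ X := by
  have h := LinearMap.finrank_range_add_finrank_ker (f.domRestrict X)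
  rw [LinearMap.range_domRestrict, LinearMap.ker_domRestrict] at h
  rw [← h, ← Submodule.map_comap_subtype, Submodule.finrank_map_subtype_eq]

theorem exists_relative_compl [FiniteDimensional ℂ V] {A C : Submodule ℂ V} (h : A ≤ C) :
    ∃ B : Submodule ℂ V, A ⊔ B = C ∧ finrank ℂ A + finrank ℂ B = finrank ℂ C := by
  obtain ⟨A', hA'⟩ := Submodule.exists_isCompl A
  have hsup : A ⊔ A' ⊓ C = C := by
    rw [← sup_inf_assoc_of_le _ h, hA'.sup_eq_top, top_inf_eq]
  refine ⟨A' ⊓ C, hsup, ?_⟩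
  have := Submodule.finrank_sup_add_finrank_inf_eq A (A' ⊓ C)
  rw [hsup, ← inf_assoc, hA'.inf_eq_bot, bot_inf_eq, finrank_bot] at this
  omega

theorem exists_family_span [FiniteDimensional ℂ V] {B : Submodule ℂ V} {m : ℕ}
    (h : finrank ℂ B = m) : ∃ f : Fin m → V, Submodule.span ℂ (Set.range f) = B := by
  refine ⟨fun i => finBasisOfFinrankEq ℂ B h i, ?_⟩
  have := congrArg (Submodule.map B.subtype) (finBasisOfFinrankEq ℂ B h).span_eq
  rwa [Submodule.map_span, Submodule.map_top, Submodule.range_subtype, ← Set.range_comp] at this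

/-- A `t`-stable subspace of prescribed numerical type: `t` has rank `e` on it, and its
intersection with the range of `t` has dimension `m`. -/
structure IsStable (t : End ℂ V) (e m : ℕ) (X : Submodule ℂ V) : Prop where
  le_comap : X ≤ X.comap t
  finrank_map : finrank ℂ (X.map t) = e
  finrank_inf : finrank ℂ ↥(X ⊓ LinearMap.range t) = m

theorem IsStable.map {t : End ℂ V} {t' : End ℂ W} (θ : V ≃ₗ[ℂ] W) (hθ : ∀ v, θ (t v) = t' (θ v))
    {e m : ℕ} {X : Submodule ℂ V} (h : IsStable t e m X) :
    IsStable t' e m (X.map (θ : V →ₗ[ℂ] W)) := by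
  have hcomp : t' ∘ₗ (θ : V →ₗ[ℂ] W) = (θ : V →ₗ[ℂ] W) ∘ₗ t := LinearMap.ext fun v => (hθ v).symm
  refine ⟨?_, ?_, ?_⟩
  · rintro _ ⟨x, hx, rfl⟩
    exact ⟨t x, h.le_comap hx, hθ x⟩
  · rw [← Submodule.map_comp, hcomp, Submodule.map_comp, LinearEquiv.finrank_map_eq,
      h.finrank_map]
  · have hr : LinearMap.range t' = (LinearMap.range t).map (θ : V →ₗ[ℂ] W) := by
      rw [← LinearMap.range_comp, ← hcomp, LinearMap.range_comp, LinearEquiv.range,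
        Submodule.map_top]
    rw [hr, ← Submodule.map_inf _ θ.injective, LinearEquiv.finrank_map_eq, h.finrank_inf]

/-- The rank on the quotient is the dimension of the image of im t in V/X, that is r - dim(X ∩ im
t). The bound `r₂ ≤ r` keeps the natural subtraction faithful. -/
theorem mem_variety_iff {n w₁ r r₁ r₂ : ℕ} {t : End ℂ (Fin n → ℂ)}
    (ht : finrank ℂ (LinearMap.range t) = r) (hr : r₂ ≤ r) (X : Gr w₁ n) :
    X ∈ variety t w₁ r₁ r₂ ↔ IsStable t r₁ (r - r₂) X.1 := by
  have h1 : ∀ h : X.1 ≤ X.1.comap t,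
      finrank ℂ (LinearMap.range (t.restrict h)) = finrank ℂ (X.1.map t) := by
    intro h
    rw [← Submodule.finrank_map_subtype_eq X.1 (LinearMap.range (t.restrict h)),
      ← LinearMap.range_comp, LinearMap.subtype_comp_restrict, LinearMap.range_domRestrict]
  have h2 : ∀ h : X.1 ≤ X.1.comap t, finrank ℂ (LinearMap.range (X.1.mapQ X.1 t h)) +
      finrank ℂ ↥(X.1 ⊓ LinearMap.range t) = r := by
    intro h
    have := finrank_map_add_finrank_inf_ker X.1.mkQ (LinearMap.range t)
    rw [Submodule.ker_mkQ, ht, inf_comm] at this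
    rw [Submodule.range_mapQ, this]
  constructor
  · rintro ⟨h, h₁, h₂⟩
    have := h1 h
    have := h2 h
    exact ⟨h, by omega, by omega⟩
  · intro h
    have := h1 h.1
    have := h2 h.1
    have := h.2
    have := h.3
    exact ⟨h.1, by omega, by omega⟩

theorem le_of_mem_variety {n w₁ r r₁ r₂ : ℕ} {t : End ℂ (Fin n → ℂ)}
    (ht : finrank ℂ (LinearMap.range t) = r) {X : Gr w₁ n} (hX : X ∈ variety t w₁ r₁ r₂) :
    r₂ ≤ r := by
  obtain ⟨h, -, h₂⟩ := hX
  rw [Submodule.range_mapQ] at h₂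
  have := Submodule.finrank_map_le X.1.mkQ (LinearMap.range t)
  omega

/-- Compare dimensions in tX ⊆ X ∩ im t, in X ∩ im t ⊆ X ∩ ker t and in (X ∩ ker t) + im t ⊆ ker t.
-/
theorem IsStable.inequalities [FiniteDimensional ℂ V] {t : End ℂ V} (ht : ∀ v, t (t v) = 0)
    {e m : ℕ} {X : Submodule ℂ V} (h : IsStable t e m X) :
    e ≤ m ∧ m + e ≤ finrank ℂ X ∧
      finrank ℂ X + 2 * finrank ℂ (LinearMap.range t) ≤ finrank ℂ V + e + m := by
  have hrk : LinearMap.range t ≤ LinearMap.ker t := by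
    rintro _ ⟨v, rfl⟩
    exact ht v
  have h1 : X.map t ≤ X ⊓ LinearMap.range t :=
    le_inf (Submodule.map_le_iff_le_comap.2 h.le_comap) LinearMap.map_le_range
  have h2 := Submodule.finrank_mono h1
  have h3 := Submodule.finrank_mono (inf_le_inf_left X hrk)
  have h4 := finrank_map_add_finrank_inf_ker t X
  have h5 := LinearMap.finrank_range_add_finrank_ker t
  have h6 := Submodule.finrank_sup_add_finrank_inf_eq (X ⊓ LinearMap.ker t) (LinearMap.range t)
  have h7 : finrank ℂ ↥(X ⊓ LinearMap.ker t ⊔ LinearMap.range t) ≤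
      finrank ℂ (LinearMap.ker t) := Submodule.finrank_mono (sup_le inf_le_right hrk)
  rw [inf_assoc, inf_eq_right.2 hrk] at h6
  have := h.2
  have := h.3
  omega

end Dimension

/-! ### Normal forms -/

section NormalForm

/-- Index set of the part of an adapted basis which lies in the stable subspace. The endomorphism
sends the third block to the fourth. -/
abbrev InIdx (b d e : ℕ) : Type := (Fin b ⊕ Fin d) ⊕ (Fin e ⊕ Fin e)

/-- Index set of the part of an adapted basis which is complementary to the stable subspace.
The endomorphism sends the first block to the second, and the third block to the second block of
`InIdx`. -/
abbrev OutIdx (d c a : ℕ) : Type := (Fin c ⊕ Fin c) ⊕ (Fin d ⊕ Fin a)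

/-- Index set of an adapted basis. -/
abbrev Idx (b d e c a : ℕ) : Type := InIdx b d e ⊕ OutIdx d c a

/-- The square-zero endomorphism in normal form. -/
def stdEnd (b d e c a : ℕ) : End ℂ (Idx b d e c a → ℂ) where
  toFun y := Sum.elim
    (Sum.elim (Sum.elim (0 : Fin b → ℂ) fun i => y (.inr (.inr (.inl i))))
      (Sum.elim (0 : Fin e → ℂ) fun i => y (.inl (.inr (.inl i)))))
    (Sum.elim (Sum.elim (0 : Fin c → ℂ) fun i => y (.inr (.inl (.inl i))))
      (0 : Fin d ⊕ Fin a → ℂ))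
  map_add' y z := by
    ext i
    rcases i with ((_ | _) | (_ | _)) | ((_ | _) | (_ | _)) <;> simp
  map_smul' c y := by
    ext i
    rcases i with ((_ | _) | (_ | _)) | ((_ | _) | (_ | _)) <;> simp

variable {b d e c a : ℕ}

theorem stdEnd_apply (y : Idx b d e c a → ℂ) : stdEnd b d e c a y = Sum.elim
    (Sum.elim (Sum.elim (0 : Fin b → ℂ) fun i => y (.inr (.inr (.inl i))))
      (Sum.elim (0 : Fin e → ℂ) fun i => y (.inl (.inr (.inl i)))))
    (Sum.elim (Sum.elim (0 : Fin c → ℂ) fun i => y (.inr (.inl (.inl i))))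
      (0 : Fin d ⊕ Fin a → ℂ)) := rfl

theorem stdEnd_stdEnd (y : Idx b d e c a → ℂ) : stdEnd b d e c a (stdEnd b d e c a y) = 0 := by
  ext i
  rcases i with ((_ | _) | (_ | _)) | ((_ | _) | (_ | _)) <;> simp [stdEnd_apply]

variable {V : Type*} [AddCommGroup V] [Module ℂ V] [FiniteDimensional ℂ V]

/-- The pair (t, X) has no invariants besides b, d, e, c, a; this gives non-emptiness, homogeneity
under the centralizer of t, and the charts. -/
theorem exists_adapted_equiv {t : End ℂ V} (ht : ∀ v, t (t v) = 0) {X : Submodule ℂ V}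
    (hX : IsStable t e (e + d) X) (hXd : finrank ℂ X = b + d + e + e)
    (hr : finrank ℂ (LinearMap.range t) = e + d + c)
    (hV : finrank ℂ V = b + d + e + e + (c + c + d + a)) :
    ∃ θ : V ≃ₗ[ℂ] (Idx b d e c a → ℂ), (∀ v, θ (t v) = stdEnd b d e c a (θ v)) ∧
      ∀ v, v ∈ X ↔ ∀ j, θ v (.inr j) = 0 := by
  have hrk : LinearMap.range t ≤ LinearMap.ker t := by
    rintro _ ⟨v, rfl⟩
    exact ht v
  have hker := LinearMap.finrank_range_add_finrank_ker t
  have hXker := finrank_map_add_finrank_inf_ker t X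
  have hsup := Submodule.finrank_sup_add_finrank_inf_eq (X ⊓ LinearMap.ker t) (LinearMap.range t)
  rw [inf_assoc, inf_eq_right.2 hrk] at hsup
  have hf := hX.2
  have hi := hX.3
  -- D, C, B, A have dimensions d, c, b, a: D completes tX to X ∩ im t, C completes that to im t, B
  -- completes X ∩ im t to X ∩ ker t, and A completes (X ∩ ker t) + im t to ker t.
  obtain ⟨D, hD, hDd⟩ := exists_relative_compl (A := X.map t) (C := X ⊓ LinearMap.range t)
    (le_inf (Submodule.map_le_iff_le_comap.2 hX.le_comap) LinearMap.map_le_range)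
  obtain ⟨C, hC, hCd⟩ := exists_relative_compl (A := X ⊓ LinearMap.range t)
    (C := LinearMap.range t) inf_le_right
  obtain ⟨B, hB, hBd⟩ := exists_relative_compl (inf_le_inf_left X hrk)
  obtain ⟨A, hA, hAd⟩ := exists_relative_compl
    (A := X ⊓ LinearMap.ker t ⊔ LinearMap.range t) (C := LinearMap.ker t)
    (sup_le inf_le_right hrk)
  obtain ⟨vte, hte⟩ := exists_family_span hf
  obtain ⟨vtd, htd⟩ := exists_family_span (B := D) (m := d) (by omega)
  obtain ⟨vtc, htc⟩ := exists_family_span (B := C) (m := c) (by omega)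
  obtain ⟨vb, hb⟩ := exists_family_span (B := B) (m := b) (by omega)
  obtain ⟨va, ha⟩ := exists_family_span (B := A) (m := a) (by omega)
  have mem_of_span : ∀ {m : ℕ} {f : Fin m → V} {S : Submodule ℂ V},
      Submodule.span ℂ (Set.range f) = S → ∀ i, f i ∈ S :=
    fun h i => h ▸ Submodule.subset_span ⟨i, rfl⟩
  have hDr : D ≤ X ⊓ LinearMap.range t := hD ▸ le_sup_right
  have hCr : C ≤ LinearMap.range t := hC ▸ le_sup_right
  have hBr : B ≤ X ⊓ LinearMap.ker t := hB ▸ le_sup_right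
  have hAr : A ≤ LinearMap.ker t := hA ▸ le_sup_right
  -- Lifts along t: those of tX are taken inside X, those of D and C anywhere in V.
  choose ve hveX hve using fun i => mem_of_span hte i
  choose vd hvd using fun i => (hDr (mem_of_span htd i)).2
  choose vc hvc using fun i => hCr (mem_of_span htc i)
  let v : Idx b d e c a → V := Sum.elim (Sum.elim (Sum.elim vb vtd) (Sum.elim ve vte))
    (Sum.elim (Sum.elim vc vtc) (Sum.elim vd va))
  let S := Submodule.span ℂ (Set.range v)
  let S₁ := Submodule.span ℂ (Set.range fun i => v (.inl i))
  have hS₁S : S₁ ≤ S := Submodule.span_mono (Set.range_comp_subset_range Sum.inl v)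
  have mem₁ : ∀ i, v (.inl i) ∈ S₁ := fun i => Submodule.subset_span ⟨i, rfl⟩
  have mem : ∀ i, v i ∈ S := fun i => Submodule.subset_span ⟨i, rfl⟩
  have hte₁ : X.map t ≤ S₁ := by
    rw [← hte, Submodule.span_le]
    rintro _ ⟨i, rfl⟩
    exact mem₁ (.inr (.inr i))
  have hD₁ : D ≤ S₁ := by
    rw [← htd, Submodule.span_le]
    rintro _ ⟨i, rfl⟩
    exact mem₁ (.inl (.inr i))
  have hB₁ : B ≤ S₁ := by
    rw [← hb, Submodule.span_le]
    rintro _ ⟨i, rfl⟩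
    exact mem₁ (.inl (.inl i))
  have hCS : C ≤ S := by
    rw [← htc, Submodule.span_le]
    rintro _ ⟨i, rfl⟩
    exact mem (.inr (.inl (.inr i)))
  have hAS : A ≤ S := by
    rw [← ha, Submodule.span_le]
    rintro _ ⟨i, rfl⟩
    exact mem (.inr (.inr (.inr i)))
  have hte' : X.map t ≤ S₁.map t := by
    refine hte.symm.le.trans (Submodule.span_le.2 ?_)
    rintro _ ⟨i, rfl⟩
    exact ⟨ve i, mem₁ (.inr (.inl i)), hve i⟩
  have hD' : D ≤ S.map t := by
    rw [← htd, Submodule.span_le]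
    rintro _ ⟨i, rfl⟩
    exact ⟨vd i, mem (.inr (.inr (.inl i))), hvd i⟩
  have hC' : C ≤ S.map t := by
    rw [← htc, Submodule.span_le]
    rintro _ ⟨i, rfl⟩
    exact ⟨vc i, mem (.inr (.inl (.inl i))), hvc i⟩
  have hS₁X : S₁ ≤ X := by
    rw [Submodule.span_le]
    rintro _ ⟨(i | i) | (i | i), rfl⟩
    · exact (hBr (mem_of_span hb i)).1
    · exact (hDr (mem_of_span htd i)).1
    · exact hveX i
    · exact Submodule.map_le_iff_le_comap.2 hX.le_comap (mem_of_span hte i)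
  have hXr₁ : X ⊓ LinearMap.range t ≤ S₁ := hD ▸ sup_le hte₁ hD₁
  have hXk₁ : X ⊓ LinearMap.ker t ≤ S₁ := hB ▸ sup_le hXr₁ hB₁
  -- Subtracting an element of S₁ with the same image under t leaves an element of X ∩ ker t,
  -- already known to lie in S₁. The argument for S = V is the same.
  have hXS₁ : X ≤ S₁ := by
    intro x hx
    obtain ⟨s, hs, hst⟩ := hte' ⟨x, hx, rfl⟩
    have h0 : x - s ∈ S₁ := hXk₁ ⟨X.sub_mem hx (hS₁X hs), by simp [hst]⟩
    simpa using S₁.add_mem h0 hs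
  have hrS : LinearMap.range t ≤ S := hC ▸ sup_le (hXr₁.trans hS₁S) hCS
  have hkS : LinearMap.ker t ≤ S := hA ▸ sup_le (sup_le (hXk₁.trans hS₁S) hrS) hAS
  have hrS' : LinearMap.range t ≤ S.map t :=
    hC ▸ sup_le (hD ▸ sup_le (hte'.trans (Submodule.map_mono hS₁S)) hD') hC'
  have hS : ⊤ ≤ S := by
    intro x _
    obtain ⟨s, hs, hst⟩ := hrS' ⟨x, rfl⟩
    have h0 : x - s ∈ S := hkS (by simp [hst])
    simpa using S.add_mem h0 hs
  -- The number of vectors equals dim V, so spanning suffices and independence is free.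
  let bas := basisOfTopLeSpanOfCardEqFinrank v hS (by simp [hV]; ring)
  have hbas : ∀ i, bas i = v i := fun i => by simp [bas]
  refine ⟨bas.equivFun, fun x => ?_, fun x => ⟨fun hx => ?_, fun hx => ?_⟩⟩
  · obtain ⟨y, rfl⟩ := bas.equivFun.symm.surjective x
    rw [LinearEquiv.apply_symm_apply]
    apply bas.equivFun.symm.injective
    rw [LinearEquiv.symm_apply_apply, Basis.equivFun_symm_apply, Basis.equivFun_symm_apply,
      map_sum]
    have hb0 : ∀ i, t (vb i) = 0 := fun i => (hBr (mem_of_span hb i)).2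
    have ha0 : ∀ i, t (va i) = 0 := fun i => hAr (mem_of_span ha i)
    have htd0 : ∀ i, t (vtd i) = 0 := fun i => hvd i ▸ ht _
    have htc0 : ∀ i, t (vtc i) = 0 := fun i => hvc i ▸ ht _
    have hte0 : ∀ i, t (vte i) = 0 := fun i => hve i ▸ ht _
    simp only [map_smul, hbas, v, Fintype.sum_sum_type, Sum.elim_inl, Sum.elim_inr, hb0, htd0,
      hve, hte0, hvc, htc0, hvd, ha0, stdEnd_apply, smul_zero, Finset.sum_const_zero, zero_add,
      add_zero, Pi.zero_apply, zero_smul]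
    abel
  · intro j
    have hle : S₁ ≤ LinearMap.ker (bas.coord (.inr j)) := by
      rw [Submodule.span_le]
      rintro _ ⟨i, rfl⟩
      simp [← hbas]
    exact hle (hXS₁ hx)
  · rw [← bas.sum_equivFun x, Fintype.sum_sum_type]
    simp only [hx, zero_smul, Finset.sum_const_zero, add_zero, hbas]
    exact X.sum_mem fun i _ => X.smul_mem _ (hS₁X (mem₁ i))

end NormalForm

end Spaltenstein

namespace Spaltenstein

open Module

/-! ### Graphs of matrices -/

section Graph

variable {I O : Type} [Fintype I]

/-- The linear parametrization of the graph of a matrix. -/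
def graphMap (M : Matrix O I ℂ) : (I → ℂ) →ₗ[ℂ] (I ⊕ O → ℂ) where
  toFun x := Sum.elim x (M.mulVec x)
  map_add' x y := by
    ext i
    rcases i with i | i <;> simp [Matrix.mulVec_add]
  map_smul' r x := by
    ext i
    rcases i with i | i <;> simp [Matrix.mulVec_smul]

@[simp] theorem graphMap_inl (M : Matrix O I ℂ) (x : I → ℂ) (i : I) :
    graphMap M x (.inl i) = x i := rfl

@[simp] theorem graphMap_inr (M : Matrix O I ℂ) (x : I → ℂ) (j : O) :
    graphMap M x (.inr j) = M.mulVec x j := rfl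

theorem injective_graphMap (M : Matrix O I ℂ) : Function.Injective (graphMap M) :=
  fun _ _ h => funext fun i => congrFun h (.inl i)

theorem mem_range_graphMap {M : Matrix O I ℂ} {y : I ⊕ O → ℂ} :
    y ∈ LinearMap.range (graphMap M) ↔
      ∀ j, y (.inr j) = M.mulVec (fun i => y (.inl i)) j := by
  constructor
  · rintro ⟨x, rfl⟩ j
    rfl
  · intro h
    refine ⟨fun i => y (.inl i), funext fun i => ?_⟩
    rcases i with i | j
    · rfl
    · exact (h j).symm

theorem exists_eq_range_graphMap [Fintype O] {Y : Submodule ℂ (I ⊕ O → ℂ)}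
    (hY : finrank ℂ Y = Fintype.card I) (h : ∀ y ∈ Y, (∀ i, y (.inl i) = 0) → y = 0) :
    ∃ M : Matrix O I ℂ, Y = LinearMap.range (graphMap M) := by
  classical
  let π : Y →ₗ[ℂ] (I → ℂ) := (LinearMap.funLeft ℂ ℂ Sum.inl).domRestrict Y
  have hinj : Function.Injective π := (injective_iff_map_eq_zero π).2 fun y hy =>
    Subtype.ext (h y y.2 fun i => congrFun hy i)
  have hsurj : Function.Surjective π :=
    (LinearMap.injective_iff_surjective_of_finrank_eq_finrank (by simp [hY])).1 hinj
  let ε := LinearEquiv.ofBijective π ⟨hinj, hsurj⟩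
  let g : (I → ℂ) →ₗ[ℂ] (O → ℂ) :=
    (LinearMap.funLeft ℂ ℂ Sum.inr).comp (Y.subtype.comp ε.symm.toLinearMap)
  have hg : ∀ y : Y, g (fun i => y.1 (.inl i)) = fun j => y.1 (.inr j) := by
    intro y
    have : ε.symm (fun i => y.1 (.inl i)) = y := ε.symm_apply_eq.2 rfl
    funext j
    simp [g, this, LinearMap.funLeft]
  have hle : Y ≤ LinearMap.range (graphMap (LinearMap.toMatrix' g)) := by
    intro y hy
    rw [mem_range_graphMap]
    intro j
    rw [LinearMap.toMatrix'_mulVec, hg ⟨y, hy⟩]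
  refine ⟨LinearMap.toMatrix' g, Submodule.eq_of_le_of_finrank_eq hle ?_⟩
  rw [LinearMap.finrank_range_of_inj (injective_graphMap _), hY, Module.finrank_fintype_fun_eq_card]

theorem finrank_ker_funLeft {α β : Type} [Fintype α] [Fintype β] {f : α → β}
    (hf : Function.Injective f) :
    finrank ℂ (LinearMap.ker (LinearMap.funLeft ℂ ℂ f)) + Fintype.card α = Fintype.card β := by
  have h := LinearMap.finrank_range_add_finrank_ker (LinearMap.funLeft ℂ ℂ f)
  rw [LinearMap.range_eq_top.2 (LinearMap.funLeft_surjective_of_injective ℂ ℂ f hf),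
    finrank_top, Module.finrank_fintype_fun_eq_card, Module.finrank_fintype_fun_eq_card] at h
  omega

end Graph

/-! ### Stable subspaces near a given one -/

section Cell

variable {b d e c a : ℕ}

theorem mem_range_stdEnd {y : Idx b d e c a → ℂ} : y ∈ LinearMap.range (stdEnd b d e c a) ↔
    (∀ i, y (.inl (.inl (.inl i))) = 0) ∧ (∀ i, y (.inl (.inr (.inl i))) = 0) ∧
    (∀ i, y (.inr (.inl (.inl i))) = 0) ∧ ∀ i, y (.inr (.inr i)) = 0 := by
  constructor
  · rintro ⟨x, rfl⟩
    simp [stdEnd_apply]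
  · rintro ⟨h1, h2, h3, h4⟩
    refine ⟨Sum.elim (Sum.elim 0 (Sum.elim (fun i => y (.inl (.inr (.inr i)))) 0))
      (Sum.elim (Sum.elim (fun i => y (.inr (.inl (.inr i)))) 0)
        (Sum.elim (fun i => y (.inl (.inl (.inr i)))) 0)), ?_⟩
    ext i
    rcases i with ((_ | _) | (_ | _)) | ((_ | _) | _) <;> simp [stdEnd_apply, h1, h2, h3, h4]

theorem finrank_range_stdEnd :
    finrank ℂ (LinearMap.range (stdEnd b d e c a)) = e + d + c := by
  let f : Fin c ⊕ (Fin d ⊕ Fin e) → Idx b d e c a :=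
    Sum.elim (fun i => .inr (.inl (.inl i)))
      (Sum.elim (fun i => .inr (.inr (.inl i))) fun i => .inl (.inr (.inl i)))
  have hf : Function.Injective f := by
    rintro (i | i | i) (j | j | j) h <;> simp_all [f]
  have hk : LinearMap.ker (stdEnd b d e c a) = LinearMap.ker (LinearMap.funLeft ℂ ℂ f) := by
    ext y
    simp only [LinearMap.mem_ker]
    constructor
    · intro h
      ext i
      rcases i with i | i | i
      · exact congrFun h (.inr (.inl (.inr i)))
      · exact congrFun h (.inl (.inl (.inr i)))
      · exact congrFun h (.inl (.inr (.inr i)))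
    · intro h
      have h1 : ∀ i, y (.inr (.inl (.inl i))) = 0 := fun i => congrFun h (.inl i)
      have h2 : ∀ i, y (.inr (.inr (.inl i))) = 0 := fun i => congrFun h (.inr (.inl i))
      have h3 : ∀ i, y (.inl (.inr (.inl i))) = 0 := fun i => congrFun h (.inr (.inr i))
      ext i
      rcases i with ((_ | _) | (_ | _)) | ((_ | _) | _) <;> simp [stdEnd_apply, h1, h2, h3]
  have h1 := finrank_ker_funLeft hf
  have h2 := LinearMap.finrank_range_add_finrank_ker (stdEnd b d e c a)
  rw [hk, Module.finrank_fintype_fun_eq_card] at h2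
  simp only [Fintype.card_sum, Fintype.card_fin] at h1 h2
  omega

/-- The equations of the stable subspaces in the big cell around a given one. -/
structure IsNormal (M : Matrix (OutIdx d c a) (InIdx b d e) ℂ) : Prop where
  d_left : ∀ i j, M (.inr (.inl i)) (.inl j) = 0
  d_right : ∀ i j, M (.inr (.inl i)) (.inr (.inr j)) = 0
  a_left : ∀ i j, M (.inr (.inr i)) (.inl (.inr j)) = 0
  a_right : ∀ i j, M (.inr (.inr i)) (.inr (.inr j)) = 0
  c_left : ∀ i j, M (.inl (.inl i)) (.inl j) = 0
  c_right : ∀ i j, M (.inl (.inl i)) (.inr (.inr j)) = 0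
  c_mid : ∀ i j, M (.inl (.inl i)) (.inr (.inl j)) = M (.inl (.inr i)) (.inr (.inr j)) +
    ∑ l, M (.inl (.inr i)) (.inl (.inr l)) * M (.inr (.inl l)) (.inr (.inl j))

variable {M : Matrix (OutIdx d c a) (InIdx b d e) ℂ}

/-- The image under t records the third-block coordinates, so the kernel on the graph always lies in
their vanishing locus, of codimension e. Rank e means equality. -/
theorem finrank_map_range_graphMap :
    finrank ℂ ((LinearMap.range (graphMap M)).map (stdEnd b d e c a)) = e ↔
      LinearMap.ker (LinearMap.funLeft ℂ ℂ fun i : Fin e => (.inr (.inl i) : InIdx b d e)) ≤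
        LinearMap.ker (stdEnd b d e c a ∘ₗ graphMap M) := by
  set K := LinearMap.ker (LinearMap.funLeft ℂ ℂ fun i : Fin e => (.inr (.inl i) : InIdx b d e))
  have hK : finrank ℂ K + e = b + d + (e + e) := by
    have := finrank_ker_funLeft (f := fun i : Fin e => (.inr (.inl i) : InIdx b d e))
      (fun i j h => by simpa using h)
    simpa using this
  have hle : LinearMap.ker (stdEnd b d e c a ∘ₗ graphMap M) ≤ K := by
    intro x hx
    ext i
    exact congrFun (LinearMap.mem_ker.1 hx) (.inl (.inr (.inr i)))
  rw [← LinearMap.range_comp]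
  have h := LinearMap.finrank_range_add_finrank_ker (stdEnd b d e c a ∘ₗ graphMap M)
  rw [Module.finrank_fintype_fun_eq_card] at h
  simp only [Fintype.card_sum, Fintype.card_fin] at h
  constructor
  · intro he
    have hfin : finrank ℂ (LinearMap.ker (stdEnd b d e c a ∘ₗ graphMap M)) = finrank ℂ K := by
      omega
    exact (Submodule.eq_of_le_of_finrank_eq hle hfin).ge
  · intro hge
    have : finrank ℂ (LinearMap.ker (stdEnd b d e c a ∘ₗ graphMap M)) = finrank ℂ K := by
      rw [le_antisymm hle hge]
    omega

/-- A vector of im t has zero first- and third-block coordinates, so the intersection has dimension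
at most d + e, with equality iff all such graph vectors lie in im t. -/
theorem finrank_range_graphMap_inf :
    finrank ℂ ↥(LinearMap.range (graphMap M) ⊓ LinearMap.range (stdEnd b d e c a)) = e + d ↔
      LinearMap.ker (LinearMap.funLeft ℂ ℂ
        (Sum.elim (fun i => .inl (.inl i)) fun i => .inr (.inl i) :
          Fin b ⊕ Fin e → InIdx b d e)) ≤
        (LinearMap.range (stdEnd b d e c a)).comap (graphMap M) := by
  set f : Fin b ⊕ Fin e → InIdx b d e :=
    Sum.elim (fun i => .inl (.inl i)) fun i => .inr (.inl i)
  have hK := finrank_ker_funLeft (f := f) (by rintro (i | i) (j | j) h <;> simp_all [f])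
  have hle : (LinearMap.range (stdEnd b d e c a)).comap (graphMap M) ≤
      LinearMap.ker (LinearMap.funLeft ℂ ℂ f) := by
    intro x hx
    have := mem_range_stdEnd.1 hx
    ext i
    rcases i with i | i
    · exact this.1 i
    · exact this.2.1 i
  rw [← Submodule.map_comap_eq, 
    ← (Submodule.equivMapOfInjective _ (injective_graphMap M) _).finrank_eq]
  simp only [Fintype.card_sum, Fintype.card_fin] at hK
  constructor
  · intro he
    exact (Submodule.eq_of_le_of_finrank_eq hle (by omega)).ge
  · intro hge
    rw [le_antisymm hle hge]
    omega

/-- The two dimension conditions produce the vanishing entries. Granted these, stability adds only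
`c_mid`, which expresses one block through free entries. -/
theorem isStable_range_graphMap_iff :
    IsStable (stdEnd b d e c a) e (e + d) (LinearMap.range (graphMap M)) ↔ IsNormal M := by
  classical
  constructor
  · rintro ⟨h1, h2, h3⟩
    rw [finrank_map_range_graphMap] at h2
    rw [finrank_range_graphMap_inf] at h3
    have k2 : ∀ (j : InIdx b d e), (∀ i, j ≠ .inr (.inl i)) →
        stdEnd b d e c a (graphMap M (Pi.single j 1)) = 0 := fun j hj =>
      h2 (LinearMap.mem_ker.2 (funext fun i => Pi.single_eq_of_ne (hj i).symm _))
    have k3 : ∀ (j : InIdx b d e), (∀ i, j ≠ .inl (.inl i)) → (∀ i, j ≠ .inr (.inl i)) →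
        graphMap M (Pi.single j 1) ∈ LinearMap.range (stdEnd b d e c a) := fun j hj hj' =>
      h3 (LinearMap.mem_ker.2 (funext fun i => by
        rcases i with i | i
        · exact Pi.single_eq_of_ne (hj i).symm _
        · exact Pi.single_eq_of_ne (hj' i).symm _))
    have kd : ∀ j, (∀ i, j ≠ .inr (.inl i)) → ∀ i, M (.inr (.inl i)) j = 0 := fun j hj i => by
      simpa [stdEnd_apply] using congrFun (k2 j hj) (.inl (.inl (.inr i)))
    have kc : ∀ j, (∀ i, j ≠ .inr (.inl i)) → ∀ i, M (.inl (.inl i)) j = 0 := fun j hj i => by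
      simpa [stdEnd_apply] using congrFun (k2 j hj) (.inr (.inl (.inr i)))
    have ka : ∀ j, (∀ i, j ≠ .inl (.inl i)) → (∀ i, j ≠ .inr (.inl i)) →
        ∀ i, M (.inr (.inr i)) j = 0 := fun j hj hj' i => by
      simpa using (mem_range_stdEnd.1 (k3 j hj hj')).2.2.2 (.inr i)
    refine ⟨fun i j => kd _ (by simp) i, fun i j => kd _ (by simp) i,
      fun i j => ka _ (by simp) (by simp) i, fun i j => ka _ (by simp) (by simp) i,
      fun i j => kc _ (by simp) i, fun i j => kc _ (by simp) i, fun i j => ?_⟩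
    -- Apply t to the graph vector over a third-block basis vector and compare coordinates in the
    -- image of the c-block: this is `c_mid`.
    have := mem_range_graphMap.1 (h1 ⟨Pi.single (.inr (.inl j)) 1, rfl⟩) (.inl (.inr i))
    rw [stdEnd_apply] at this
    simp only [Sum.elim_inr, Sum.elim_inl, graphMap_inr, Matrix.mulVec_single_one, Matrix.col_apply]
      at this
    rw [this, Matrix.mulVec, dotProduct]
    simp [Fintype.sum_sum_type, Pi.single_apply]
    ring
  · intro h
    refine ⟨?_, finrank_map_range_graphMap.2 ?_, finrank_range_graphMap_inf.2 ?_⟩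
    · rintro _ ⟨x, rfl⟩
      refine mem_range_graphMap.2 fun j => ?_
      simp only [Matrix.mulVec, dotProduct, Fintype.sum_sum_type, stdEnd_apply, Sum.elim_inl,
        Sum.elim_inr, graphMap_inl, graphMap_inr, Pi.zero_apply, mul_zero, Finset.sum_const_zero,
        zero_add]
      rcases j with (i | i) | (i | i)
      · simp [h.c_left, h.c_right]
      · simp only [Sum.elim_inl, Sum.elim_inr, h.c_left, h.c_right, h.d_left, h.d_right, h.c_mid,
          zero_mul, add_zero, zero_add, Finset.sum_const_zero, add_mul, Finset.sum_add_distrib,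
          Finset.sum_mul, Finset.mul_sum]
        rw [add_comm, Finset.sum_comm]
        simp only [mul_assoc]
      · simp [h.d_left, h.d_right]
      · simp [h.a_left, h.a_right]
    · intro x hx
      have hx0 : ∀ i, x (.inr (.inl i)) = 0 := fun i => congrFun (LinearMap.mem_ker.1 hx) i
      refine LinearMap.mem_ker.2 (funext fun j => ?_)
      rcases j with ((_ | _) | (_ | _)) | ((_ | _) | _) <;>
        simp [stdEnd_apply, Matrix.mulVec, dotProduct, Fintype.sum_sum_type, hx0, h.d_left,
          h.d_right, h.c_left, h.c_right]
    · intro x hx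
      have hx0 : ∀ i, x (.inl (.inl i)) = 0 := fun i => congrFun (LinearMap.mem_ker.1 hx) (.inl i)
      have hx1 : ∀ i, x (.inr (.inl i)) = 0 := fun i => congrFun (LinearMap.mem_ker.1 hx) (.inr i)
      refine mem_range_stdEnd.2 ⟨fun i => hx0 i, fun i => hx1 i, fun i => ?_, fun i => ?_⟩
      · simp [Matrix.mulVec, dotProduct, Fintype.sum_sum_type, hx1, h.c_left, h.c_right]
      · rcases i with i | i <;>
        simp [Matrix.mulVec, dotProduct, Fintype.sum_sum_type, hx0, hx1, h.d_left, h.d_right,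
          h.a_left, h.a_right]

/-- Index set of the local coordinates around a stable subspace. -/
abbrev CellIdx (b d e c a : ℕ) : Type :=
  (Fin c × InIdx b d e) ⊕ ((Fin d × Fin e) ⊕ (Fin a × (Fin b ⊕ Fin e)))

/-- The position in the matrix of a local coordinate. -/
def cellPos : CellIdx b d e c a → OutIdx d c a × InIdx b d e
  | .inl (i, j) => (.inl (.inr i), j)
  | .inr (.inl (i, j)) => (.inr (.inl i), .inr (.inl j))
  | .inr (.inr (i, .inl j)) => (.inr (.inr i), .inl (.inl j))
  | .inr (.inr (i, .inr j)) => (.inr (.inr i), .inr (.inl j))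

/-- The matrix with given local coordinates. -/
def cellMatrix (x : CellIdx b d e c a → ℂ) : Matrix (OutIdx d c a) (InIdx b d e) ℂ
  | .inl (.inl i), .inr (.inl j) => x (.inl (i, .inr (.inr j))) +
      ∑ l, x (.inl (i, .inl (.inr l))) * x (.inr (.inl (l, j)))
  | .inl (.inl _), .inl _ => 0
  | .inl (.inl _), .inr (.inr _) => 0
  | .inl (.inr i), j => x (.inl (i, j))
  | .inr (.inl i), .inr (.inl j) => x (.inr (.inl (i, j)))
  | .inr (.inl _), .inl _ => 0
  | .inr (.inl _), .inr (.inr _) => 0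
  | .inr (.inr i), .inl (.inl j) => x (.inr (.inr (i, .inl j)))
  | .inr (.inr i), .inr (.inl j) => x (.inr (.inr (i, .inr j)))
  | .inr (.inr _), .inl (.inr _) => 0
  | .inr (.inr _), .inr (.inr _) => 0

theorem isNormal_cellMatrix (x : CellIdx b d e c a → ℂ) : IsNormal (cellMatrix x) :=
  ⟨fun _ _ => rfl, fun _ _ => rfl, fun _ _ => rfl, fun _ _ => rfl, fun _ _ => rfl,
    fun _ _ => rfl, fun _ _ => rfl⟩

theorem cellMatrix_cellPos (x : CellIdx b d e c a → ℂ) (f : CellIdx b d e c a) :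
    cellMatrix x (cellPos f).1 (cellPos f).2 = x f := by
  rcases f with ⟨i, j⟩ | ⟨i, j⟩ | ⟨i, j | j⟩ <;> rfl

theorem IsNormal.eq_cellMatrix (h : IsNormal M) :
    M = cellMatrix fun f => M (cellPos f).1 (cellPos f).2 := by
  ext i j
  rcases i with (i | i) | (i | i) <;> rcases j with (j | j) | (j | j) <;>
    simp [cellMatrix, cellPos, h.d_left, h.d_right, h.a_left, h.a_right, h.c_left, h.c_right,
      h.c_mid]

theorem isPoly_cellMatrix (i : OutIdx d c a) (j : InIdx b d e) :
    IsPoly fun x : CellIdx b d e c a → ℂ => cellMatrix x i j := by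
  rcases i with (i | i) | (i | i) <;> rcases j with (j | j) | (j | j) <;>
    first
    | exact IsPoly.const 0
    | exact IsPoly.coord _
    | exact (IsPoly.coord _).add (IsPoly.sum _ fun l => (IsPoly.coord _).mul (IsPoly.coord _))

end Cell

end Spaltenstein

namespace Spaltenstein

open Module

/-! ### The big cell in Plücker coordinates -/

section CellChart

variable {b d e c a k n : ℕ} {t : End ℂ (Fin n → ℂ)}
  (θ : (Fin n → ℂ) ≃ₗ[ℂ] (Idx b d e c a → ℂ)) (ε : Fin k ≃ InIdx b d e)

/-- The basis of a subspace in the big cell which corresponds to a matrix. -/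
def cellFrame (M : Matrix (OutIdx d c a) (InIdx b d e) ℂ) (i : Fin k) : Fin n → ℂ := by
  classical
  exact θ.symm (graphMap M (Pi.single (ε i) 1))

theorem linearIndependent_cellFrame (M : Matrix (OutIdx d c a) (InIdx b d e) ℂ) :
    LinearIndependent ℂ (cellFrame θ ε M) := by
  classical
  have h := ((Pi.basisFun ℂ (InIdx b d e)).linearIndependent.comp ε ε.injective).map'
    (θ.symm.toLinearMap ∘ₗ graphMap M)
    (LinearMap.ker_eq_bot.2 (θ.symm.injective.comp (injective_graphMap M)))
  have hfun : cellFrame θ ε M =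
      (θ.symm.toLinearMap ∘ₗ graphMap M) ∘ (Pi.basisFun ℂ (InIdx b d e)) ∘ ε := by
    funext i
    simp [cellFrame]
  rw [hfun]
  exact h

theorem span_cellFrame (M : Matrix (OutIdx d c a) (InIdx b d e) ℂ) :
    Submodule.span ℂ (Set.range (cellFrame θ ε M)) =
      (LinearMap.range (graphMap M)).map θ.symm.toLinearMap := by
  classical
  have h : cellFrame θ ε M =
      (θ.symm.toLinearMap ∘ₗ graphMap M) ∘ (Pi.basisFun ℂ (InIdx b d e)) ∘ ε := by
    funext i
    simp [cellFrame]
  rw [h, Set.range_comp, ← Submodule.map_span, ε.surjective.range_comp, Basis.span_eq,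
    Submodule.map_comp, Submodule.map_top]

/-- The subspace in the big cell which corresponds to a matrix. -/
def cellSubspace (M : Matrix (OutIdx d c a) (InIdx b d e) ℂ) : Gr k n :=
  ⟨(LinearMap.range (graphMap M)).map θ.symm.toLinearMap, by
    rw [← span_cellFrame θ ε M, finrank_span_eq_card (linearIndependent_cellFrame θ ε M),
      Fintype.card_fin]⟩

theorem plucker_cellSubspace (M : Matrix (OutIdx d c a) (InIdx b d e) ℂ) :
    plucker (cellSubspace θ ε M) = Projectivization.mk ℂ (minors (cellFrame θ ε M))
      (minors_ne_zero _ (linearIndependent_cellFrame θ ε M)) :=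
  plucker_eq_mk _ (linearIndependent_cellFrame θ ε M) (span_cellFrame θ ε M)

variable {θ} (hθ : ∀ v, θ (t v) = stdEnd b d e c a (θ v))
  {S : Set (Gr k n)} (hS : ∀ X, X ∈ S ↔ IsStable t e (e + d) X.1)

include hθ hS

theorem cellSubspace_mem_iff (M : Matrix (OutIdx d c a) (InIdx b d e) ℂ) :
    cellSubspace θ ε M ∈ S ↔ IsNormal M := by
  rw [hS, ← isStable_range_graphMap_iff]
  constructor
  · intro h
    have := h.map θ hθ
    rwa [cellSubspace, ← Submodule.map_comp, LinearEquiv.comp_coe, θ.symm_trans_self,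
      LinearEquiv.refl_toLinearMap, Submodule.map_id] at this
  · intro h
    refine h.map θ.symm fun v => ?_
    rw [θ.symm_apply_eq, hθ, θ.apply_symm_apply]

/-- In the adapted basis, the minor on the `InIdx` columns is the denominator, and an entry of M is
the minor with one of these columns replaced by an `OutIdx` column. -/
theorem exists_linearChart : ∃ χ : LinearChart (plucker '' S) (CellIdx b d e c a),
    ∀ x, χ.param x = minors (cellFrame θ ε (cellMatrix x)) := by
  classical
  let form : (Fin k → Idx b d e c a) → (Fin n → ℂ) [⋀^Fin k]→ₗ[ℂ] ℂ := fun h =>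
    Matrix.detRowAlternating.compLinearMap (LinearMap.funLeft ℂ ℂ h ∘ₗ θ.toLinearMap)
  have hform : ∀ h v, form h v = (Matrix.of fun i j => θ (v i) (h j)).det := fun _ _ => rfl
  choose l hl using fun h => exists_dual_minors (form h)
  let pos₀ : Fin k → Idx b d e c a := fun j => .inl (ε j)
  let pos : CellIdx b d e c a → Fin k → Idx b d e c a := fun f j =>
    if j = ε.symm (cellPos f).2 then .inr (cellPos f).1 else .inl (ε j)
  refine ⟨{
    param := fun x => minors (cellFrame θ ε (cellMatrix x))
    isPoly_param := ?_
    denom := l pos₀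
    coord := fun f => l (pos f)
    denom_param := ?_
    coord_param := ?_
    mk_mem := ?_
    exists_param := ?_ }, fun x => rfl⟩
  · refine fun s => IsPoly.det fun i j => ?_
    simp only [Matrix.of_apply, cellFrame]
    refine IsPoly.comp (f := fun y => θ.symm y (s j))
      (φ := fun x => graphMap (cellMatrix x) (Pi.single (ε i) 1))
      (IsPoly.linear (LinearMap.proj (s j) ∘ₗ θ.symm.toLinearMap)) fun m => ?_
    rcases m with m | m
    · exact IsPoly.const _
    · simpa using isPoly_cellMatrix m (ε i)
  · intro x
    rw [hl, hform, ← Matrix.det_one (n := Fin k)]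
    congr 1
    ext i j
    simp [cellFrame, pos₀, Matrix.one_apply, Pi.single_apply, eq_comm]
  · intro x f
    rw [hl, hform]
    -- The frame is the identity on the `InIdx` columns; after replacing one column, the determinant
    -- is the single entry left on the diagonal.
    have h : (Matrix.of fun i j => θ (cellFrame θ ε (cellMatrix x) i) (pos f j)) =
        (1 : Matrix (Fin k) (Fin k) ℂ).updateCol (ε.symm (cellPos f).2)
          fun i => cellMatrix x (cellPos f).1 (ε i) := by
      ext i j
      by_cases hj : j = ε.symm (cellPos f).2
      · simp [cellFrame, pos, hj]
      · simp [cellFrame, pos, hj, Matrix.one_apply, Pi.single_apply,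
          eq_comm]
    rw [h, ← Matrix.cramer_apply, Matrix.cramer_one]
    simp [cellMatrix_cellPos]
  · intro x h
    refine ⟨cellSubspace θ ε (cellMatrix x), ?_, plucker_cellSubspace θ ε _⟩
    rw [cellSubspace_mem_iff ε hθ hS]
    exact isNormal_cellMatrix x
  · rintro _ ⟨X, hX, rfl⟩ hd
    let B := finBasisOfFinrankEq ℂ X.1 X.2
    have hdet : (Matrix.of fun i j => θ (B i) (pos₀ j)).det ≠ 0 := by
      rw [plucker, dual_rep_mk_ne_zero_iff, hl, hform] at hd
      exact hd
    have hcard : finrank ℂ (X.1.map θ.toLinearMap) = Fintype.card (InIdx b d e) := by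
      rw [LinearEquiv.finrank_map_eq, X.2, ← Fintype.card_congr ε, Fintype.card_fin]
    obtain ⟨M, hM⟩ := exists_eq_range_graphMap hcard (by
      rintro _ ⟨x, hx, rfl⟩ h0
      have hsum := B.sum_equivFun ⟨x, hx⟩
      have hx' : x = ∑ i, B.equivFun ⟨x, hx⟩ i • (B i : Fin n → ℂ) := by
        have := congrArg X.1.subtype hsum
        rw [map_sum] at this
        exact this.symm
      -- The non-zero minor says that X projects injectively to the `InIdx` coordinates, so X is a
      -- graph.
      have hc : B.equivFun ⟨x, hx⟩ = 0 := by
        refine Matrix.eq_zero_of_vecMul_eq_zero hdet (funext fun j => ?_)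
        have := h0 (ε j)
        rw [hx'] at this
        simpa [Matrix.vecMul, dotProduct, pos₀, Finset.sum_apply] using this
      rw [hx', hc]
      simp)
    have hXM : X = cellSubspace θ ε M := by
      refine Subtype.ext ?_
      change X.1 = (LinearMap.range (graphMap M)).map θ.symm.toLinearMap
      rw [← hM, ← Submodule.map_comp, LinearEquiv.comp_coe, θ.self_trans_symm,
        LinearEquiv.refl_toLinearMap, Submodule.map_id]
    rw [hXM, cellSubspace_mem_iff ε hθ hS] at hX
    obtain ⟨u, hu⟩ := Projectivization.exists_smul_eq_mk_rep ℂ _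
      (minors_ne_zero _ (linearIndependent_cellFrame θ ε M))
    refine ⟨fun f => M (cellPos f).1 (cellPos f).2, (u : ℂ), ?_⟩
    rw [hXM, plucker_cellSubspace, ← hu, ← hX.eq_cellMatrix, Units.smul_def]

end CellChart

/-! ### Charts at every point, non-emptiness, connectedness -/

section Charts

/-- The adapted basis for X = V, where only b and e survive: a square-zero map is determined up to
conjugacy by its rank. -/
theorem exists_equiv_of_finrank_range {V : Type} [AddCommGroup V] [Module ℂ V]
    [FiniteDimensional ℂ V] {t : End ℂ V} (ht : ∀ v, t (t v) = 0) {r m : ℕ}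
    (hr : finrank ℂ (LinearMap.range t) = r) (hm : finrank ℂ V = m) :
    2 * r ≤ m ∧ ∃ θ : V ≃ₗ[ℂ] (Idx (m - 2 * r) 0 r 0 0 → ℂ),
      ∀ v, θ (t v) = stdEnd (m - 2 * r) 0 r 0 0 (θ v) := by
  have h2 : 2 * r ≤ m := by
    have h := LinearMap.finrank_range_add_finrank_ker t
    have hrk : LinearMap.range t ≤ LinearMap.ker t := by
      rintro _ ⟨v, rfl⟩
      exact ht v
    have := Submodule.finrank_mono hrk
    omega
  have hst : IsStable t r (r + 0) ⊤ :=
    ⟨fun _ _ => trivial, by rw [Submodule.map_top, hr], by rw [top_inf_eq, hr, add_zero]⟩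
  obtain ⟨θ, hθ, -⟩ := exists_adapted_equiv (b := m - 2 * r) (c := 0) (a := 0) ht hst
    (by rw [finrank_top]; omega) hr (by omega)
  exact ⟨h2, θ, hθ⟩

variable {b d e c a k n : ℕ} {t : End ℂ (Fin n → ℂ)} (ht : ∀ v, t (t v) = 0)
  (hr : finrank ℂ (LinearMap.range t) = e + d + c) (hk : k = b + d + e + e)
  (hn : n = b + d + e + e + (c + c + d + a))
  {S : Set (Gr k n)} (hS : ∀ X, X ∈ S ↔ IsStable t e (e + d) X.1)

include ht hr hk hn hS

theorem exists_adapted_equiv_of_mem {X : Gr k n} (hX : X ∈ S) :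
    ∃ θ : (Fin n → ℂ) ≃ₗ[ℂ] (Idx b d e c a → ℂ), (∀ v, θ (t v) = stdEnd b d e c a (θ v)) ∧
      ∀ v, v ∈ X.1 ↔ ∀ j, θ v (.inr j) = 0 :=
  exists_adapted_equiv ht ((hS X).1 hX) (X.2.trans hk) hr (by simpa using hn)

theorem exists_linearChart_of_mem : ∀ p ∈ plucker '' S,
    ∃ χ : LinearChart (plucker '' S) (CellIdx b d e c a), p ∈ χ.source := by
  rintro _ ⟨X, hX, rfl⟩
  obtain ⟨θ, hθ, hθX⟩ := exists_adapted_equiv_of_mem ht hr hk hn hS hX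
  obtain ⟨ε⟩ : Nonempty (Fin k ≃ InIdx b d e) := ⟨Fintype.equivOfCardEq (by simp [hk]; ring)⟩
  obtain ⟨χ, hχ⟩ := exists_linearChart ε hθ hS
  have hX0 : X = cellSubspace θ ε 0 := by
    refine Subtype.ext (Submodule.ext fun v => ?_)
    rw [hθX, cellSubspace]
    constructor
    · intro h
      exact ⟨θ v, mem_range_graphMap.2 (by simpa using h), by simp⟩
    · rintro ⟨y, hy, rfl⟩
      simpa using mem_range_graphMap.1 hy
  have hN : IsNormal (0 : Matrix (OutIdx d c a) (InIdx b d e) ℂ) := by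
    rw [← cellSubspace_mem_iff ε hθ hS, ← hX0]
    exact hX
  refine ⟨χ, ?_⟩
  have : plucker X = χ.toProj fun _ => 0 := by
    have h0 := hN.eq_cellMatrix
    simp only [Matrix.zero_apply] at h0
    simp only [LinearChart.toProj, hχ, ← h0]
    rw [hX0, plucker_cellSubspace]
  rw [this]
  exact ((χ.range_toProj).le ⟨_, rfl⟩).2

/-- `t` and `stdEnd` have the same rank on spaces of the same dimension, so they are conjugate; the
origin of the cell is then a point. -/
theorem nonempty_of_finrank : S.Nonempty := by
  obtain ⟨h2, θ₁, hθ₁⟩ := exists_equiv_of_finrank_range ht hr (m := n) (by simp)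
  obtain ⟨-, θ₂, hθ₂⟩ := exists_equiv_of_finrank_range (m := n)
    (stdEnd_stdEnd (b := b) (d := d) (e := e) (c := c) (a := a)) finrank_range_stdEnd
    (by simp [hn]; ring)
  obtain ⟨ε⟩ : Nonempty (Fin k ≃ InIdx b d e) := ⟨Fintype.equivOfCardEq (by simp [hk]; ring)⟩
  have hθ : ∀ v, (θ₁.trans θ₂.symm) (t v) = stdEnd b d e c a ((θ₁.trans θ₂.symm) v) := by
    intro v
    rw [LinearEquiv.trans_apply, LinearEquiv.trans_apply, θ₂.symm_apply_eq, hθ₁, hθ₂,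
      LinearEquiv.apply_symm_apply]
  exact ⟨_, (cellSubspace_mem_iff ε hθ hS _).2 (isNormal_cellMatrix 0)⟩

theorem exists_commuting_equiv {X Y : Gr k n} (hX : X ∈ S) (hY : Y ∈ S) :
    ∃ g : (Fin n → ℂ) ≃ₗ[ℂ] (Fin n → ℂ), (∀ v, g (t v) = t (g v)) ∧
      X.1.map g.toLinearMap = Y.1 := by
  obtain ⟨θ, hθ, hθX⟩ := exists_adapted_equiv_of_mem ht hr hk hn hS hX
  obtain ⟨η, hη, hηY⟩ := exists_adapted_equiv_of_mem ht hr hk hn hS hY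
  refine ⟨θ.trans η.symm, fun v => ?_, Submodule.ext fun v => ?_⟩
  · simp only [LinearEquiv.trans_apply]
    rw [η.symm_apply_eq, hθ, hη, η.apply_symm_apply]
  · rw [hηY]
    constructor
    · rintro ⟨x, hx, rfl⟩
      simpa using (hθX x).1 hx
    · intro h
      exact ⟨θ.symm (η v), (hθX _).2 (by simpa using h), by simp⟩

attribute [local instance] zariskiAffine zariskiProj

/-- The maps (1 - s)·id + s·g commute with t, so the invertible ones carry X to points of S. The
admissible s form an open subset of the affine line, which is irreducible, and s = 0, 1 give X and
Y. -/
theorem isConnectedVariety_of_finrank : IsConnectedVariety (plucker '' S) := by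
  refine ⟨(nonempty_of_finrank ht hr hk hn hS).image _, isPreconnected_of_forall_pair ?_⟩
  rintro _ ⟨X, hX, rfl⟩ _ ⟨Y, hY, rfl⟩
  obtain ⟨g, hgt, hgX⟩ := exists_commuting_equiv ht hr hk hn hS hX hY
  let B := finBasisOfFinrankEq ℂ X.1 X.2
  let v : Fin k → Fin n → ℂ := fun i => B i
  have hv : LinearIndependent ℂ v :=
    B.linearIndependent.map' X.1.subtype X.1.ker_subtype
  have hvX : Submodule.span ℂ (Set.range v) = X.1 := by
    have := congrArg (Submodule.map X.1.subtype) B.span_eq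
    rwa [Submodule.map_span, Submodule.map_top, Submodule.range_subtype, ← Set.range_comp] at this
  let h : (Unit → ℂ) → End ℂ (Fin n → ℂ) := fun s =>
    (1 - s ()) • LinearMap.id + s () • g.toLinearMap
  have hs : IsPoly fun s : Unit → ℂ => s () := IsPoly.coord ()
  have hlin : ∀ x y : ℂ, IsPoly fun s : Unit → ℂ => (1 - s ()) * x + s () * y := fun x y =>
    (((IsPoly.const 1).sub hs).mul (IsPoly.const x)).add (hs.mul (IsPoly.const y))
  let D : Set (Unit → ℂ) := {s | (LinearMap.toMatrix' (h s)).det ≠ 0}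
  have hDo : IsOpen D := by
    refine IsPoly.isOpen (IsPoly.det fun i j => ?_)
    convert hlin (LinearMap.toMatrix' LinearMap.id i j) (LinearMap.toMatrix' g.toLinearMap i j)
      using 2 with s
    simp [h]
  have hDpre : PreconnectedSpace D :=
    Subtype.preconnectedSpace (isPreirreducible_of_isOpen hDo).isPreconnected
  have hDet : ∀ s, s ∈ D ↔ LinearMap.det (h s) ≠ 0 := fun s => by
    rw [← LinearMap.det_toMatrix']
    rfl
  let H : D → (Fin n → ℂ) ≃ₗ[ℂ] (Fin n → ℂ) := fun s =>
    LinearEquiv.ofIsUnitDet (v := Pi.basisFun ℂ (Fin n)) (v' := Pi.basisFun ℂ (Fin n)) (f := h s)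
      (by
        rw [LinearMap.toMatrix_eq_toMatrix']
        exact isUnit_iff_ne_zero.2 s.2)
  have hH : ∀ s, (H s).toLinearMap = h s := fun s => LinearMap.ext fun x => rfl
  have hind : ∀ s : D, LinearIndependent ℂ fun i => h s (v i) := fun s => by
    rw [← hH]
    exact hv.map' _ (H s).ker
  have hspan : ∀ s : D, Submodule.span ℂ (Set.range fun i => h s (v i)) = X.1.map (h s) := by
    intro s
    rw [← hvX, Submodule.map_span, ← Set.range_comp]
    rfl
  have hmem : ∀ (s : D) (Y : Gr k n), Y.1 = X.1.map (h s) →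
      plucker Y = Projectivization.mk ℂ _ (minors_ne_zero _ (hind s)) := fun s Y hY =>
    plucker_eq_mk Y (hind s) ((hspan s).trans hY.symm)
  refine ⟨Set.range fun s : D => Projectivization.mk ℂ _ (minors_ne_zero _ (hind s)), ?_, ?_, ?_,
    isPreconnected_range (continuous_mk _ ?_)⟩
  · rintro _ ⟨s, rfl⟩
    have hfr : finrank ℂ (X.1.map (h s)) = k := by
      rw [← hH, LinearEquiv.finrank_map_eq, X.2]
    refine ⟨⟨X.1.map (h s), hfr⟩, ?_, hmem s _ rfl⟩
    rw [hS]
    have := ((hS X).1 hX).map (H s) (t' := t) fun x => by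
      change h s (t x) = t (h s x)
      simp [h, hgt]
    rwa [hH] at this
  · have h0 : h (fun _ => 0) = LinearMap.id := by simp [h]
    refine ⟨⟨fun _ => 0, (hDet _).2 (by simp [h0])⟩, (hmem _ X ?_).symm⟩
    simp only [h0, Submodule.map_id]
  · have h1 : h (fun _ => 1) = g.toLinearMap := by simp [h]
    refine ⟨⟨fun _ => 1, (hDet _).2 ?_⟩, (hmem _ Y ?_).symm⟩
    · rw [h1]
      exact g.isUnit_det'.ne_zero
    · simp only [h1, hgX]
  · refine (continuous_of_isPoly (φ := fun s => minors fun i => h s (v i)) fun m => ?_).comp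
      continuous_subtype_val
    refine IsPoly.det fun i j => ?_
    convert hlin (v i (m j)) (g (v i) (m j)) using 2 with s
    simp [h]

end Charts

end Spaltenstein

namespace Spaltenstein

open Module Topology

/-! ### Charts of subsets of affine space -/

section AffineChart

attribute [local instance] zariskiAffine

variable {ι F : Type}

theorem exists_isPoly_clear_denom {h : (ι → ℂ) → ℂ} (hh : IsPoly h) {a : F → (ι → ℂ) → ℂ}
    (ha : ∀ j, IsPoly (a j)) (p : MvPolynomial F ℂ) :
    ∃ (m : ℕ) (H : (ι → ℂ) → ℂ), IsPoly H ∧ ∀ y, h y ≠ 0 →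
      H y = h y ^ m * MvPolynomial.eval (fun j => a j y / h y) p := by
  have hpow : ∀ m : ℕ, IsPoly fun y => h y ^ m := fun m => by
    simpa using IsPoly.prod (Finset.range m) fun _ => hh
  induction p using MvPolynomial.induction_on with
  | C z => exact ⟨0, fun _ => z, IsPoly.const z, by simp⟩
  | add p q hp hq =>
    obtain ⟨m, H, hH, k⟩ := hp
    obtain ⟨n, K, hK, l⟩ := hq
    refine ⟨m + n, fun y => h y ^ n * H y + h y ^ m * K y,
      ((hpow n).mul hH).add ((hpow m).mul hK), fun y hy => ?_⟩
    simp only [map_add, k y hy, l y hy]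
    ring
  | mul_X p j hp =>
    obtain ⟨m, H, hH, k⟩ := hp
    refine ⟨m + 1, fun y => H y * a j y, hH.mul (ha j), fun y hy => ?_⟩
    simp only [map_mul, k y hy, MvPolynomial.eval_X]
    field_simp
    ring

/-- The parameters are recovered as the regular functions a j / h, so Φ is a homeomorphism from an
open subset of affine space onto the principal open part of S. -/
theorem topologicalKrullDim_inter_of_param [Finite F] {S : Set (ι → ℂ)} {h : (ι → ℂ) → ℂ}
    (hh : IsPoly h) {Φ : (F → ℂ) → ι → ℂ} (hΦ : ∀ i, IsPoly fun x => Φ x i)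
    {a : F → (ι → ℂ) → ℂ} (ha : ∀ j, IsPoly (a j))
    (haΦ : ∀ x j, h (Φ x) ≠ 0 → a j (Φ x) = x j * h (Φ x)) (hmem : ∀ x, h (Φ x) ≠ 0 → Φ x ∈ S)
    (hsurj : ∀ y ∈ S, h y ≠ 0 → ∃ x, Φ x = y) (hne : ∃ y ∈ S, h y ≠ 0) :
    topologicalKrullDim ↥(S ∩ {y | h y ≠ 0}) = (Nat.card F : WithBot ℕ∞) := by
  let W : Set (F → ℂ) := {x | h (Φ x) ≠ 0}
  let π : W → ι → ℂ := fun x => Φ x.1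
  have hcont : Continuous π := (continuous_of_isPoly hΦ).comp continuous_subtype_val
  have hcoord : ∀ x : W, (fun j => a j (π x) / h (π x)) = x.1 := fun x => funext fun j => by
    change a j (Φ x.1) / h (Φ x.1) = x.1 j
    rw [haΦ _ _ x.2, mul_div_cancel_right₀ _ x.2]
  have hinj : Function.Injective π := fun x y hxy => by
    refine Subtype.ext ?_
    rw [← hcoord x, ← hcoord y, hxy]
  have hind : IsInducing π := by
    refine ⟨le_antisymm hcont.le_induced ?_⟩
    rw [show (instTopologicalSpaceSubtype : TopologicalSpace W) = _ from induced_generateFrom_eq]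
    refine le_generateFrom ?_
    rintro _ ⟨_, ⟨p, rfl⟩, rfl⟩
    obtain ⟨m, H, hH, k⟩ := exists_isPoly_clear_denom hh ha p
    refine isOpen_induced_iff.2 ⟨_, hH.isOpen, ?_⟩
    ext x
    have hx : h (π x) ≠ 0 := x.2
    simp only [Set.mem_preimage, Set.mem_ofPred_eq, k _ hx, hcoord]
    simp [hx]
  have hrange : Set.range π = S ∩ {y | h y ≠ 0} := by
    ext y
    constructor
    · rintro ⟨x, rfl⟩
      exact ⟨hmem _ x.2, x.2⟩
    · rintro ⟨hy, hy0⟩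
      obtain ⟨x, rfl⟩ := hsurj y hy hy0
      exact ⟨⟨x, hy0⟩, rfl⟩
  rw [← hrange, ← (IsEmbedding.mk hind hinj).toHomeomorph.isHomeomorph.topologicalKrullDim_eq]
  refine topologicalKrullDim_of_isOpen (hh.comp hΦ).isOpen ?_
  obtain ⟨y, hy, hy0⟩ := hne
  obtain ⟨x, rfl⟩ := hsurj y hy hy0
  exact ⟨x, hy0⟩

end AffineChart

/-! ### Matrices of square zero -/

section SquareZero

open Matrix

variable {b r : ℕ}

/-- Index set of a basis adapted to a square-zero endomorphism, which maps the second block to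
the third. -/
abbrev SqIdx (b r : ℕ) : Type := Fin b ⊕ (Fin r ⊕ Fin r)

/-- Index set of the local coordinates on the matrices of square zero and rank `r`. -/
abbrev SqParam (b r : ℕ) : Type :=
  (Fin r × Fin r) ⊕ ((Fin r × Fin r) ⊕ ((Fin b × Fin r) ⊕ (Fin r × Fin b)))

/-- The left factor of a matrix of square zero. -/
def sqLeft (C₁ : Matrix (Fin b) (Fin r) ℂ) (C₂ : Matrix (Fin r) (Fin r) ℂ) :
    Matrix (SqIdx b r) (Fin r) ℂ := fromRows C₁ (fromRows C₂ 1)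

/-- The right factor of a matrix of square zero. -/
def sqRight (N : Matrix (Fin r) (Fin r) ℂ) (R : Matrix (Fin r) (Fin b) ℂ)
    (C₁ : Matrix (Fin b) (Fin r) ℂ) (C₂ : Matrix (Fin r) (Fin r) ℂ) :
    Matrix (Fin r) (SqIdx b r) ℂ := fromCols R (fromCols N (-(R * C₁ + N * C₂)))

/-- The block of a matrix which is invertible near a square-zero endomorphism in normal form. -/
def sqBlock (T : Matrix (SqIdx b r) (SqIdx b r) ℂ) : Matrix (Fin r) (Fin r) ℂ :=
  T.submatrix (fun i => .inr (.inr i)) fun i => .inr (.inl i)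

variable (N : Matrix (Fin r) (Fin r) ℂ) (R : Matrix (Fin r) (Fin b) ℂ)
    (C₁ : Matrix (Fin b) (Fin r) ℂ) (C₂ : Matrix (Fin r) (Fin r) ℂ)

theorem sqRight_mul_sqLeft : sqRight N R C₁ C₂ * sqLeft C₁ C₂ = 0 := by
  rw [sqRight, sqLeft, fromCols_mul_fromRows, fromCols_mul_fromRows, Matrix.mul_one, ← add_assoc,
    add_neg_cancel]

theorem sqLeft_mul_sqRight : sqLeft C₁ C₂ * sqRight N R C₁ C₂ =
    fromRows (C₁ * sqRight N R C₁ C₂)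
      (fromRows (C₂ * sqRight N R C₁ C₂) (sqRight N R C₁ C₂)) := by
  rw [sqLeft, fromRows_mul, fromRows_mul, Matrix.one_mul]

theorem sqBlock_mul : sqBlock (sqLeft C₁ C₂ * sqRight N R C₁ C₂) = N := by
  rw [sqLeft_mul_sqRight]
  rfl

theorem sq_mul : (sqLeft C₁ C₂ * sqRight N R C₁ C₂) * (sqLeft C₁ C₂ * sqRight N R C₁ C₂) = 0 := by
  rw [Matrix.mul_assoc, ← Matrix.mul_assoc (sqRight N R C₁ C₂), sqRight_mul_sqLeft,
    Matrix.zero_mul, Matrix.mul_zero]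

variable {N} in
theorem rank_mul_of_det_ne_zero (hN : N.det ≠ 0) :
    (sqLeft C₁ C₂ * sqRight N R C₁ C₂).rank = r := by
  refine le_antisymm ?_ ?_
  · refine (rank_mul_le_left _ _).trans ((rank_le_card_width _).trans ?_)
    simp
  · have h1 : N.rank = r := by
      rw [rank_of_isUnit _ ((isUnit_iff_isUnit_det N).2 (isUnit_iff_ne_zero.2 hN)),
        Fintype.card_fin]
    conv_lhs => rw [← h1, ← sqBlock_mul N R C₁ C₂]
    exact rank_submatrix_le _ _ _

theorem exists_eq_mul_of_rank {m n o : Type} [Fintype m] [Fintype n] [Fintype o] [DecidableEq n]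
    {T : Matrix m n ℂ} (f : o → n) (h : T.rank ≤ (T.submatrix id f).rank) :
    ∃ D : Matrix o n ℂ, T = T.submatrix id f * D := by
  have hle : Submodule.span ℂ (Set.range (T.submatrix id f).col) ≤
      Submodule.span ℂ (Set.range T.col) := Submodule.span_mono (by
    rintro _ ⟨i, rfl⟩
    exact ⟨f i, rfl⟩)
  have heq := Submodule.eq_of_le_of_finrank_le hle (by
    rwa [← rank_eq_finrank_span_cols, ← rank_eq_finrank_span_cols])
  have hcol : ∀ j, ∃ d : o → ℂ, (T.submatrix id f).mulVec d = T.col j := by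
    intro j
    have : T.col j ∈ LinearMap.range (T.submatrix id f).mulVecLin := by
      rw [range_mulVecLin, heq]
      exact Submodule.subset_span ⟨j, rfl⟩
    exact this
  choose d hd using hcol
  refine ⟨of fun i j => d j i, ?_⟩
  ext i j
  rw [← Matrix.col_apply T, ← hd j]
  rfl

/-- As the block N is invertible of size r = rank T, the columns through N span the column space,
and T = C · TT, where TT is the strip of rows through N and C has an identity block. Square zero
then means TT · C = 0, which determines the last block of TT. -/
theorem eq_sqLeft_mul_sqRight {T : Matrix (SqIdx b r) (SqIdx b r) ℂ} (hT : T * T = 0)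
    (hr : T.rank = r) (hN : (sqBlock T).det ≠ 0) :
    ∃ (N : Matrix (Fin r) (Fin r) ℂ) (R : Matrix (Fin r) (Fin b) ℂ)
      (C₁ : Matrix (Fin b) (Fin r) ℂ) (C₂ : Matrix (Fin r) (Fin r) ℂ),
      T = sqLeft C₁ C₂ * sqRight N R C₁ C₂ := by
  set N := sqBlock T
  have hu : IsUnit N.det := isUnit_iff_ne_zero.2 hN
  let TE : Matrix (SqIdx b r) (Fin r) ℂ := T.submatrix id fun i => .inr (.inl i)
  let TT : Matrix (Fin r) (SqIdx b r) ℂ := T.submatrix (fun i => .inr (.inr i)) id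
  have hrank : T.rank ≤ TE.rank := by
    have h1 : N.rank = r := by
      rw [rank_of_isUnit _ ((isUnit_iff_isUnit_det N).2 hu), Fintype.card_fin]
    rw [hr]
    conv_lhs => rw [← h1]
    exact rank_submatrix_le TE (fun i => .inr (.inr i)) id
  obtain ⟨D, hD⟩ := exists_eq_mul_of_rank _ hrank
  have hTT : TT = N * D := by
    ext i j
    exact congrFun (congrFun hD (.inr (.inr i))) j
  have hD' : D = N⁻¹ * TT := by rw [hTT, nonsing_inv_mul_cancel_left _ _ hu]
  let C := TE * N⁻¹
  have hTC : T = C * TT := by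
    rw [Matrix.mul_assoc, ← hD']
    exact hD
  have hC3 : C.toRows₂.toRows₂ = 1 := by
    rw [← mul_nonsing_inv N hu]
    rfl
  have hC : C = sqLeft C.toRows₁ C.toRows₂.toRows₁ := by
    rw [sqLeft, ← hC3, fromRows_toRows, fromRows_toRows]
  -- From C (TT C) TT = 0, cancel C on the left by its identity block and TT on the right by its
  -- invertible block N.
  have hTC0 : TT * C = 0 := by
    have h1 : C * (TT * C * TT) = 0 := by
      rw [← hT]
      conv_rhs => rw [hTC]
      simp only [Matrix.mul_assoc]
    have h2 : TT * C * TT = 0 := by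
      rw [hC, sqLeft, fromRows_mul, fromRows_mul, Matrix.one_mul] at h1
      rw [← hC3, fromRows_toRows, fromRows_toRows] at h1
      ext i j
      exact congrFun (congrFun h1 (.inr (.inr i))) j
    have h3 : TT * C * N = 0 := by
      ext i j
      exact congrFun (congrFun h2 i) (.inr (.inl j))
    rw [← mul_nonsing_inv_cancel_right N (TT * C) hu, h3, Matrix.zero_mul]
  have hR : TT = sqRight N TT.toCols₁ C.toRows₁ C.toRows₂.toRows₁ := by
    have h1 : TT = fromCols TT.toCols₁ (fromCols N TT.toCols₂.toCols₂) := by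
      conv_lhs => rw [← fromCols_toCols TT, ← fromCols_toCols TT.toCols₂]
      rfl
    have h2 : TT.toCols₁ * C.toRows₁ + (N * C.toRows₂.toRows₁ + TT.toCols₂.toCols₂) = 0 := by
      rw [← hTC0]
      conv_rhs => rw [h1, hC, sqLeft, fromCols_mul_fromRows, fromCols_mul_fromRows, Matrix.mul_one]
    rw [← add_assoc] at h2
    conv_lhs => rw [h1]
    rw [sqRight, ← eq_neg_of_add_eq_zero_right h2]
  exact ⟨N, TT.toCols₁, C.toRows₁, C.toRows₂.toRows₁, by rw [← hR, ← hC, ← hTC]⟩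

theorem isPoly_matrix_mul {ι l m n : Type} [Fintype m] {A : (ι → ℂ) → Matrix l m ℂ}
    {B : (ι → ℂ) → Matrix m n ℂ} (hA : ∀ i j, IsPoly fun x => A x i j)
    (hB : ∀ i j, IsPoly fun x => B x i j) (i : l) (j : n) : IsPoly fun x => (A x * B x) i j := by
  simp only [Matrix.mul_apply]
  exact IsPoly.sum _ fun k => (hA i k).mul (hB k j)

theorem isPoly_adjugate {ι n : Type} [Fintype n] [DecidableEq n] {A : (ι → ℂ) → Matrix n n ℂ}
    (hA : ∀ i j, IsPoly fun x => A x i j) (i j : n) : IsPoly fun x => (A x).adjugate i j := by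
  simp only [adjugate_apply]
  refine IsPoly.det fun k l => ?_
  by_cases hk : k = j
  · simpa [updateRow_apply, hk] using IsPoly.const _
  · simpa [updateRow_apply, hk] using hA k l

end SquareZero

end Spaltenstein

namespace Spaltenstein

open Module

/-! ### Dimensions of nilpotent orbits -/

section Orbit

open Matrix

variable {w b r : ℕ}

/-- Endomorphisms of `ℂⁿ` as points of affine space. -/
def matEntries (n : Type) [Fintype n] [DecidableEq n] : End ℂ (n → ℂ) ≃ₗ[ℂ] (n × n → ℂ) :=
  LinearMap.toMatrix' ≪≫ₗ (ofLinearEquiv ℂ).symm ≪≫ₗ (LinearEquiv.curry ℂ ℂ n n).symm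

/-- The matrix, with respect to an arbitrary basis, of an endomorphism given by its entries. -/
def conjMatrix (θ : (Fin w → ℂ) ≃ₗ[ℂ] (SqIdx b r → ℂ)) :
    (Fin w × Fin w → ℂ) ≃ₗ[ℂ] Matrix (SqIdx b r) (SqIdx b r) ℂ :=
  (matEntries (Fin w)).symm ≪≫ₗ θ.conj ≪≫ₗ LinearMap.toMatrix'

theorem isPoly_conjMatrix (θ : (Fin w → ℂ) ≃ₗ[ℂ] (SqIdx b r → ℂ)) (i j : SqIdx b r) :
    IsPoly fun y => conjMatrix θ y i j :=
  IsPoly.linear (Matrix.entryLinearMap ℂ ℂ i j ∘ₗ (conjMatrix θ).toLinearMap)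

theorem isPoly_conjMatrix_symm {F : Type} (θ : (Fin w → ℂ) ≃ₗ[ℂ] (SqIdx b r → ℂ))
    {A : (F → ℂ) → Matrix (SqIdx b r) (SqIdx b r) ℂ} (hA : ∀ i j, IsPoly fun x => A x i j)
    (k : Fin w × Fin w) : IsPoly fun x => (conjMatrix θ).symm (A x) k := by
  let l : (SqIdx b r × SqIdx b r → ℂ) →ₗ[ℂ] ℂ := LinearMap.proj k ∘ₗ
    ((LinearEquiv.curry ℂ ℂ _ _) ≪≫ₗ (ofLinearEquiv ℂ) ≪≫ₗ (conjMatrix θ).symm).toLinearMap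
  exact IsPoly.comp (f := fun z => l z) (φ := fun x ij => A x ij.1 ij.2) (IsPoly.linear l)
    fun ij => hA _ _

theorem mem_image_orbit_iff (θ : (Fin w → ℂ) ≃ₗ[ℂ] (SqIdx b r → ℂ)) {m : ℕ}
    {y : Fin w × Fin w → ℂ} : y ∈ matEntries (Fin w) '' orbit w m ↔
      conjMatrix θ y * conjMatrix θ y = 0 ∧ (conjMatrix θ y).rank = m := by
  obtain ⟨t, rfl⟩ := (matEntries (Fin w)).surjective y
  rw [(matEntries (Fin w)).injective.mem_set_image]
  have h1 : conjMatrix θ (matEntries (Fin w) t) = LinearMap.toMatrix' (θ.conj t) := by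
    simp [conjMatrix]
  have hsq : θ.conj t * θ.conj t = θ.conj (t ^ 2) := by
    rw [pow_two]
    exact (θ.conj_comp t t).symm
  rw [h1, ← LinearMap.toMatrix'_mul, hsq]
  have h2 : (LinearMap.toMatrix' (θ.conj t)).rank = finrank ℂ (LinearMap.range t) := by
    rw [Matrix.rank, ← Matrix.toLin'_apply', Matrix.toLin'_toMatrix', LinearEquiv.conj_apply,
      LinearMap.range_comp_of_range_eq_top _ θ.symm.range, LinearMap.range_comp,
      LinearEquiv.finrank_map_eq]
  rw [h2]
  refine and_congr_left fun _ => ?_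
  constructor
  · intro h
    rw [h, map_zero, map_zero]
  · intro h
    exact θ.conj.injective (LinearMap.toMatrix'.injective (by rw [h, map_zero, map_zero]))

theorem topologicalKrullDim_orbit_inter (θ : (Fin w → ℂ) ≃ₗ[ℂ] (SqIdx b r → ℂ))
    (hne : ∃ y ∈ matEntries (Fin w) '' orbit w r, (sqBlock (conjMatrix θ y)).det ≠ 0) :
    @topologicalKrullDim ↥(matEntries (Fin w) '' orbit w r ∩
      {y | (sqBlock (conjMatrix θ y)).det ≠ 0}) ((zariskiAffine _).induced Subtype.val) =
      (Nat.card (SqParam b r) : WithBot ℕ∞) := by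
  have hmat := isPoly_conjMatrix θ
  have hblock : ∀ i j, IsPoly fun y => sqBlock (conjMatrix θ y) i j := fun i j => hmat _ _
  have hdet : IsPoly fun y => (sqBlock (conjMatrix θ y)).det := IsPoly.det hblock
  let N : (SqParam b r → ℂ) → Matrix (Fin r) (Fin r) ℂ := fun x => of fun i j => x (.inl (i, j))
  let C₂ : (SqParam b r → ℂ) → Matrix (Fin r) (Fin r) ℂ :=
    fun x => of fun i j => x (.inr (.inl (i, j)))
  let C₁ : (SqParam b r → ℂ) → Matrix (Fin b) (Fin r) ℂ :=
    fun x => of fun i j => x (.inr (.inr (.inl (i, j))))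
  let R : (SqParam b r → ℂ) → Matrix (Fin r) (Fin b) ℂ :=
    fun x => of fun i j => x (.inr (.inr (.inr (i, j))))
  have hN : ∀ i j, IsPoly fun x => N x i j := fun i j => IsPoly.coord _
  have hC₁ : ∀ i j, IsPoly fun x => C₁ x i j := fun i j => IsPoly.coord _
  have hC₂ : ∀ i j, IsPoly fun x => C₂ x i j := fun i j => IsPoly.coord _
  have hR : ∀ i j, IsPoly fun x => R x i j := fun i j => IsPoly.coord _
  let T : (SqParam b r → ℂ) → Matrix (SqIdx b r) (SqIdx b r) ℂ := fun x =>
    sqLeft (C₁ x) (C₂ x) * sqRight (N x) (R x) (C₁ x) (C₂ x)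
  have hL : ∀ i j, IsPoly fun x => sqLeft (C₁ x) (C₂ x) i j := by
    rintro (i | i | i) j
    · exact hC₁ i j
    · exact hC₂ i j
    · exact IsPoly.const _
  have hRt : ∀ i j, IsPoly fun x => sqRight (N x) (R x) (C₁ x) (C₂ x) i j := by
    rintro i (j | j | j)
    · exact hR i j
    · exact hN i j
    · exact ((isPoly_matrix_mul hR hC₁ i j).add (isPoly_matrix_mul hN hC₂ i j)).neg
  have hT : ∀ i j, IsPoly fun x => T x i j := isPoly_matrix_mul hL hRt
  -- Numerators over det N: the strip of columns through N has blocks C₁ N, C₂ N and N, so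
  -- multiplying by the adjugate of N isolates C₁ and C₂; N and R are blocks of T itself.
  let a : SqParam b r → (Fin w × Fin w → ℂ) → ℂ := Sum.elim
    (fun ij y => sqBlock (conjMatrix θ y) ij.1 ij.2 * (sqBlock (conjMatrix θ y)).det) (Sum.elim
    (fun ij y => ((conjMatrix θ y).submatrix (fun i => .inr (.inl i)) (fun i => .inr (.inl i)) *
      (sqBlock (conjMatrix θ y)).adjugate) ij.1 ij.2) (Sum.elim
    (fun ij y => ((conjMatrix θ y).submatrix (fun i => .inl i) (fun i => .inr (.inl i)) *
      (sqBlock (conjMatrix θ y)).adjugate) ij.1 ij.2)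
    (fun ij y => conjMatrix θ y (.inr (.inr ij.1)) (.inl ij.2) *
      (sqBlock (conjMatrix θ y)).det)))
  have hblockT : ∀ x, sqBlock (T x) = N x := fun x => sqBlock_mul _ _ _ _
  have hmatT : ∀ x, conjMatrix θ ((conjMatrix θ).symm (T x)) = T x := fun x =>
    LinearEquiv.apply_symm_apply _ _
  refine topologicalKrullDim_inter_of_param hdet (Φ := fun x => (conjMatrix θ).symm (T x))
    (isPoly_conjMatrix_symm θ hT) (a := a) ?_ ?_ ?_ ?_ hne
  · rintro (⟨i, j⟩ | ⟨i, j⟩ | ⟨i, j⟩ | ⟨i, j⟩)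
    · exact (hblock i j).mul hdet
    · exact isPoly_matrix_mul (fun _ _ => hmat _ _) (isPoly_adjugate hblock) i j
    · exact isPoly_matrix_mul (fun _ _ => hmat _ _) (isPoly_adjugate hblock) i j
    · exact (hmat _ _).mul hdet
  · intro x j _
    have hTx := sqLeft_mul_sqRight (N x) (R x) (C₁ x) (C₂ x)
    rcases j with ⟨i, j⟩ | ⟨i, j⟩ | ⟨i, j⟩ | ⟨i, j⟩
    · simp only [a, Sum.elim_inl, hmatT, hblockT]
      rfl
    · simp only [a, Sum.elim_inl, Sum.elim_inr, hmatT, hblockT]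
      have : (T x).submatrix (fun i => .inr (.inl i)) (fun i => .inr (.inl i)) = C₂ x * N x := by
        simp only [T, hTx]
        rfl
      rw [this, Matrix.mul_assoc, Matrix.mul_adjugate, Matrix.mul_smul, Matrix.mul_one,
        Matrix.smul_apply, smul_eq_mul, mul_comm]
      rfl
    · simp only [a, Sum.elim_inl, Sum.elim_inr, hmatT, hblockT]
      have : (T x).submatrix (fun i => .inl i) (fun i => .inr (.inl i)) = C₁ x * N x := by
        simp only [T, hTx]
        rfl
      rw [this, Matrix.mul_assoc, Matrix.mul_adjugate, Matrix.mul_smul, Matrix.mul_one,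
        Matrix.smul_apply, smul_eq_mul, mul_comm]
      rfl
    · simp only [a, Sum.elim_inr, hmatT, hblockT]
      congr 1
      simp only [T, hTx]
      rfl
  · intro x hx
    rw [mem_image_orbit_iff θ]
    simp only [hmatT, hblockT] at hx ⊢
    exact ⟨sq_mul _ _ _ _, rank_mul_of_det_ne_zero _ _ _ hx⟩
  · intro y hy hy0
    rw [mem_image_orbit_iff θ] at hy
    obtain ⟨N', R', C₁', C₂', hy'⟩ := eq_sqLeft_mul_sqRight hy.1 hy.2 hy0
    refine ⟨Sum.elim (fun ij => N' ij.1 ij.2) (Sum.elim (fun ij => C₂' ij.1 ij.2)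
      (Sum.elim (fun ij => C₁' ij.1 ij.2) fun ij => R' ij.1 ij.2)), ?_⟩
    rw [LinearEquiv.symm_apply_eq, hy']
    rfl

/-- In a basis adapted to t the distinguished block is the identity, so the charts cover the orbit.
-/
theorem exists_equiv_sqBlock {t : End ℂ (Fin w → ℂ)} (ht : t ∈ orbit w r) :
    ∃ θ : (Fin w → ℂ) ≃ₗ[ℂ] (SqIdx (w - 2 * r) r → ℂ),
      (sqBlock (conjMatrix θ (matEntries _ t))).det ≠ 0 := by
  have ht2 : ∀ v, t (t v) = 0 := fun v => by
    rw [← Module.End.mul_apply, ← pow_two, ht.1, LinearMap.zero_apply]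
  obtain ⟨-, η, hη⟩ := exists_equiv_of_finrank_range (m := w) ht2 ht.2 (by simp)
  let f : SqIdx (w - 2 * r) r → Idx (w - 2 * r) 0 r 0 0 :=
    Sum.elim (fun i => .inl (.inl (.inl i))) fun i => .inl (.inr i)
  have hf : Function.Bijective f := by
    constructor
    · rintro (i | i) (j | j) h <;> simp_all [f]
    · rintro (((i | i) | i) | ((i | i) | (i | i)))
      · exact ⟨.inl i, rfl⟩
      · exact i.elim0
      · exact ⟨.inr i, rfl⟩
      all_goals exact i.elim0
  let σ := LinearEquiv.funCongrLeft ℂ ℂ (Equiv.ofBijective f hf)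
  have hσ : ∀ y i, σ y i = y (f i) := fun _ _ => rfl
  refine ⟨η ≪≫ₗ σ, ?_⟩
  have hone : sqBlock (conjMatrix (η ≪≫ₗ σ) (matEntries _ t)) = 1 := by
    ext i j
    simp only [sqBlock, Matrix.submatrix_apply, conjMatrix, LinearEquiv.trans_apply,
      LinearEquiv.symm_apply_apply, LinearMap.toMatrix'_apply, LinearEquiv.conj_apply_apply, hσ, hη]
    have : stdEnd (w - 2 * r) 0 r 0 0 (η ((η ≪≫ₗ σ).symm (Pi.single (.inr (.inl j)) 1)))
        (f (.inr (.inr i))) = (η ≪≫ₗ σ) ((η ≪≫ₗ σ).symm (Pi.single (.inr (.inl j)) 1))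
          (.inr (.inl i)) := rfl
    rw [this, LinearEquiv.apply_symm_apply]
    simp [Pi.single_apply, Matrix.one_apply]
  rw [hone, Matrix.det_one]
  exact one_ne_zero

theorem orbit_nonempty (h : 2 * r ≤ w) : (orbit w r).Nonempty := by
  let η : (Fin w → ℂ) ≃ₗ[ℂ] (Idx (w - 2 * r) 0 r 0 0 → ℂ) :=
    LinearEquiv.ofFinrankEq _ _ (by simp; omega)
  refine ⟨η.symm.conj (stdEnd _ _ _ _ _), ?_, ?_⟩
  · refine LinearMap.ext fun v => ?_
    simp [pow_two, LinearEquiv.conj_apply_apply, stdEnd_stdEnd]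
  · rw [LinearEquiv.conj_apply, LinearMap.range_comp_of_range_eq_top _ (LinearEquiv.range _),
      LinearMap.range_comp, LinearEquiv.finrank_map_eq, finrank_range_stdEnd]
    rfl

/-- Each chart has 2r² + 2br parameters with b = w - 2r. -/
theorem orbitDim_eq (h : 2 * r ≤ w) : orbitDim w r = ((2 * r * (w - r) : ℕ) : WithBot ℕ∞) := by
  have hcard : Nat.card (SqParam (w - 2 * r) r) = 2 * r * (w - r) := by
    obtain ⟨m, rfl⟩ := Nat.exists_eq_add_of_le h
    have h1 : 2 * r + m - 2 * r = m := by omega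
    have h2 : 2 * r + m - r = r + m := by omega
    simp only [h1, h2, Nat.card_eq_fintype_card, Fintype.card_sum, Fintype.card_prod,
      Fintype.card_fin]
    ring
  rw [← hcard]
  change @topologicalKrullDim ↥(matEntries (Fin w) '' orbit w r)
    ((zariskiAffine _).induced Subtype.val) = _
  let := zariskiAffine (Fin w × Fin w)
  refine le_antisymm (topologicalKrullDim_le_of_locally_inter ?_) ?_
  · rintro _ ⟨t, ht, rfl⟩
    obtain ⟨θ, hθ⟩ := exists_equiv_sqBlock ht
    refine ⟨{y | (sqBlock (conjMatrix θ y)).det ≠ 0}, ?_, hθ, ?_⟩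
    · exact (IsPoly.det fun i j => isPoly_conjMatrix θ _ _).isOpen
    · exact (topologicalKrullDim_orbit_inter θ ⟨_, ⟨t, ht, rfl⟩, hθ⟩).le
  · obtain ⟨t, ht⟩ := orbit_nonempty h
    obtain ⟨θ, hθ⟩ := exists_equiv_sqBlock ht
    rw [← topologicalKrullDim_orbit_inter θ ⟨_, ⟨t, ht, rfl⟩, hθ⟩]
    exact topologicalKrullDim_mono Set.inter_subset_left

end Orbit

end Spaltenstein

theorem mainTheorem5 (w₁ r₁ w₂ r₂ r : ℕ)
    (t : Module.End ℂ (Fin (w₁ + w₂) → ℂ)) (ht : t ∈ Spaltenstein.orbit (w₁ + w₂) r) :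
    (((r₁ : ℤ) + r₂ ≤ r ∧ (r : ℤ) ≤ min ((w₂ : ℤ) - r₂ + r₁) ((w₁ : ℤ) - r₁ + r₂)) →
      Spaltenstein.IsQuasiProjective
        (Spaltenstein.plucker '' Spaltenstein.variety t w₁ r₁ r₂) ∧
      Spaltenstein.IsConnectedVariety
        (Spaltenstein.plucker '' Spaltenstein.variety t w₁ r₁ r₂) ∧
      Spaltenstein.IsSmoothVariety
        (Spaltenstein.plucker '' Spaltenstein.variety t w₁ r₁ r₂) ∧
      ∃ d d₁ d₂ d₀ : ℕ,
        Spaltenstein.projDim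
          (Spaltenstein.plucker '' Spaltenstein.variety t w₁ r₁ r₂) = d ∧
        Spaltenstein.orbitDim w₁ r₁ = d₁ ∧
        Spaltenstein.orbitDim w₂ r₂ = d₂ ∧
        Spaltenstein.orbitDim (w₁ + w₂) r = d₀ ∧
        (d : ℚ) = w₁ * w₂ + 1 / 2 * ((d₁ : ℚ) + d₂ - d₀)) ∧
    (¬ ((r₁ : ℤ) + r₂ ≤ r ∧ (r : ℤ) ≤ min ((w₂ : ℤ) - r₂ + r₁) ((w₁ : ℤ) - r₁ + r₂)) →
      Spaltenstein.variety t w₁ r₁ r₂ = ∅) := by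
  have ht2 : ∀ v, t (t v) = 0 := fun v => by
    rw [← Module.End.mul_apply, ← pow_two, ht.1, LinearMap.zero_apply]
  refine ⟨fun ⟨h1, h2⟩ => ?_, fun hcon => ?_⟩
  · rw [le_min_iff] at h2
    -- The slacks of the three inequalities become the block sizes of the normal form, with e = r₁
    -- and c = r₂.
    obtain ⟨d, hd⟩ : ∃ d, r = r₁ + d + r₂ := ⟨r - r₁ - r₂, by omega⟩
    obtain ⟨b, hb⟩ : ∃ b, w₁ = b + d + r₁ + r₁ := ⟨w₁ - d - r₁ - r₁, by omega⟩
    obtain ⟨a, ha⟩ : ∃ a, w₂ = r₂ + r₂ + d + a := ⟨w₂ - r₂ - r₂ - d, by omega⟩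
    have hS : ∀ X, X ∈ Spaltenstein.variety t w₁ r₁ r₂ ↔
        Spaltenstein.IsStable t r₁ (r₁ + d) X.1 := fun X => by
      rw [Spaltenstein.mem_variety_iff ht.2 (by omega), show r - r₂ = r₁ + d by omega]
    have hr := ht.2.trans hd
    have hn : w₁ + w₂ = b + d + r₁ + r₁ + (r₂ + r₂ + d + a) := by omega
    have hcharts := Spaltenstein.exists_linearChart_of_mem ht2 hr hb hn hS
    have hne := (Spaltenstein.nonempty_of_finrank ht2 hr hb hn hS).image Spaltenstein.plucker
    refine ⟨Spaltenstein.isQuasiProjective_of_charts hcharts,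
      Spaltenstein.isConnectedVariety_of_finrank ht2 hr hb hn hS,
      Spaltenstein.isSmoothVariety_of_charts hcharts, _, _, _, _,
      Spaltenstein.projDim_of_charts hcharts hne,
      Spaltenstein.orbitDim_eq (by omega), Spaltenstein.orbitDim_eq (by omega),
      Spaltenstein.orbitDim_eq (by omega), ?_⟩
    have k1 : w₁ - r₁ = b + d + r₁ := by omega
    have k2 : w₂ - r₂ = r₂ + d + a := by omega
    have k0 : w₁ + w₂ - r = b + d + r₁ + (r₂ + a) := by omega
    rw [k1, k2, k0, hd, hb, ha]
    simp only [Fintype.card_sum, Fintype.card_prod, Fintype.card_fin]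
    push_cast
    ring
  · refine Set.eq_empty_of_forall_notMem fun X hX => hcon ?_
    have hle := Spaltenstein.le_of_mem_variety ht.2 hX
    have hst := ((Spaltenstein.mem_variety_iff ht.2 hle X).1 hX).inequalities ht2
    rw [X.2, ht.2, Module.finrank_fintype_fun_eq_card, Fintype.card_fin] at hst
    rw [le_min_iff]
    omega
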